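/- Let $\mathcal I$ be the set of open, nonempty, nondense intervals (arcs) of the unit circle $S^1$, let $\mathrm{M\ddot ob}\simeq \mathrm{PSL}(2,\mathbb R)$ be the group of transformations $z\mapsto\frac{az+b}{\overline b z+\overline a}$ ($a,b\in\mathbb C$, $|a|^2-|b|^2=1$) of $S^1$, and let $\rho_\alpha$ denote the rotation $z\mapsto e^{i\alpha}z$. A Möbius covariant local net on $S^1$ is a map $\mathcal A$ assigning to each $I\in\mathcal I$ a von Neumann algebra $\mathcal A(I)$ on a fixed complex Hilbert space $\mathcal H$, together with a strongly continuous unitary representation $U$ of $\mathrm{M\ddot ob}$ on $\mathcal H$, such that for all $I_1,I_2,I\in\mathcal I$ and $\varphi\in\mathrm{M\ddot ob}$: (i) $I_1\subset I_2$ implies $\mathcal A(I_1)\subset\mathcal A(I_2)$; (ii) $I_1\cap I_2=\emptyset$ implies $[\mathcal A(I_1),\mathcal A(I_2)]=0$; (iii) $U(\varphi)\mathcal A(I)U(\varphi)^{-1}=\mathcal A(\varphi(I))$; (iv) the conformal Hamiltonian $L_0$, i.e. the self-adjoint operator defined by $U(\rho_\alpha)=e^{i\alpha L_0}$ ($\alpha\in\mathbb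 R$), is positive; (v) there is a $U$-invariant unit vector $\Omega\in\mathcal H$, the vacuum vector, and it is unique up to a phase; (vi) $\Omega$ is cyclic for $\bigl(\bigcup_{I\in\mathcal I}\mathcal A(I)\bigr)''$. For $I\in\mathcal I$ let $$\mathcal A^\infty(I)=\{A\in\mathcal A(I):\ \alpha\mapsto U(\rho_\alpha)AU(\rho_\alpha)^*\ \text{is } C^\infty \text{ in the operator norm}\}.$$ Theorem. Let $(\mathcal A,U)$ be a Möbius covariant local net with vacuum vector $\Omega$ and conformal Hamiltonian $L_0$, and let $k>0$ be a real number. Then for every interval $I\in\mathcal I$ the subspace $\mathcal A^\infty(I)\Omega$ is a core for $L_0^k$; that is, $\mathcal A^\infty(I)\Omega$ is contained in the domain of $L_0^k$ and the closure of the restriction of $L_0^k$ to it is $L_0^k$. -/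

import Mathlib

open scoped ContDiff ComplexConjugate

/-! ### The Möbius group of the circle -/

/-- Coefficients `(a, b) ∈ ℂ²` with `|a|² - |b|² = 1`. -/
@[ext]
structure MobCoeff where
  a : ℂ
  b : ℂ
  normSq_sub : Complex.normSq a - Complex.normSq b = 1

namespace MobCoeff

/-- The topology of `MobCoeff` as a subset of `ℂ²`. -/
noncomputable instance : TopologicalSpace MobCoeff :=
  TopologicalSpace.induced (fun p => (p.a, p.b)) inferInstance

theorem a_mul_conj_sub (p : MobCoeff) : p.a * conj p.a - p.b * conj p.b = 1 := by
  have h := p.normSq_sub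
  rw [Complex.mul_conj, Complex.mul_conj]
  exact_mod_cast h

/-- Coefficients of the composition. -/
def mul (p q : MobCoeff) : MobCoeff where
  a := p.a * q.a + p.b * conj q.b
  b := p.a * q.b + p.b * conj q.a
  normSq_sub := by
    have hp := p.a_mul_conj_sub
    have hq := q.a_mul_conj_sub
    have : ((Complex.normSq (p.a * q.a + p.b * conj q.b)
        - Complex.normSq (p.a * q.b + p.b * conj q.a) : ℝ) : ℂ) = 1 := by
      rw [Complex.ofReal_sub, ← Complex.mul_conj, ← Complex.mul_conj]
      simp only [map_add, map_mul, Complex.conj_conj]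
      linear_combination (q.a * conj q.a - q.b * conj q.b) * hp + hq
    exact_mod_cast this

/-- Coefficients of the inverse. -/
def inv (p : MobCoeff) : MobCoeff where
  a := conj p.a
  b := -p.b
  normSq_sub := by
    rw [Complex.normSq_conj, Complex.normSq_neg]
    exact p.normSq_sub

theorem denom_ne_zero (p : MobCoeff) (z : Circle) : conj p.b * (z : ℂ) + conj p.a ≠ 0 := by
  intro h
  have h1 : conj p.b * (z : ℂ) = -conj p.a := eq_neg_of_add_eq_zero_left h
  have h2 := congrArg Complex.normSq h1
  rw [Complex.normSq_mul, Complex.normSq_neg, Complex.normSq_conj, Complex.normSq_conj,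
    Circle.normSq_coe, mul_one] at h2
  have h3 := p.normSq_sub
  linarith

/-- The transformation `z ↦ (a z + b) / (b̄ z + ā)` of the circle. -/
noncomputable def toFun (p : MobCoeff) (z : Circle) : Circle :=
  ⟨(p.a * z + p.b) / (conj p.b * z + conj p.a), by
    have hd := p.denom_ne_zero z
    have hz : (z : ℂ) * conj (z : ℂ) = 1 := by
      rw [Complex.mul_conj, Circle.normSq_coe, Complex.ofReal_one]
    have hn : Complex.normSq (p.a * z + p.b) = Complex.normSq (conj p.b * z + conj p.a) := by
      have : ((Complex.normSq (p.a * z + p.b) : ℝ) : ℂ)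
          = (Complex.normSq (conj p.b * z + conj p.a) : ℝ) := by
        rw [← Complex.mul_conj, ← Complex.mul_conj]
        simp only [map_add, map_mul, Complex.conj_conj]
        linear_combination (p.a * conj p.a - p.b * conj p.b) * hz
      exact_mod_cast this
    have hns : Complex.normSq (conj p.b * z + conj p.a) ≠ 0 := by
      simpa [Complex.normSq_eq_zero] using hd
    change _ ∈ Metric.sphere (0 : ℂ) 1
    rw [mem_sphere_zero_iff_norm, norm_div, div_eq_one_iff_eq (by simpa using hd), Complex.norm_def, Complex.norm_def, hn]⟩

theorem coe_toFun (p : MobCoeff) (z : Circle) :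
    (p.toFun z : ℂ) = (p.a * z + p.b) / (conj p.b * z + conj p.a) := rfl

theorem toFun_mul (p q : MobCoeff) (z : Circle) : (p.mul q).toFun z = p.toFun (q.toFun z) := by
  apply Circle.ext
  have h1 := (p.mul q).denom_ne_zero z
  have h2 := p.denom_ne_zero (q.toFun z)
  have h3 := q.denom_ne_zero z
  rw [coe_toFun] at h2
  rw [coe_toFun, coe_toFun, coe_toFun, div_eq_div_iff h1 h2]
  simp only [mul, map_add, map_mul, Complex.conj_conj] at h3 ⊢
  field_simp
  ring

theorem toFun_inv_left (p : MobCoeff) (z : Circle) : p.inv.toFun (p.toFun z) = z := by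
  apply Circle.ext
  have h2 := p.inv.denom_ne_zero (p.toFun z)
  have h3 : (p.toFun z : ℂ) * (conj p.b * z + conj p.a) = p.a * z + p.b :=
    div_mul_cancel₀ _ (p.denom_ne_zero z)
  rw [coe_toFun, div_eq_iff h2]
  simp only [inv, map_neg, Complex.conj_conj]
  linear_combination h3

theorem inv_inv (p : MobCoeff) : p.inv.inv = p := by
  simp [inv]

theorem continuous_toFun (p : MobCoeff) : Continuous p.toFun := by
  refine Continuous.subtype_mk ?_ _
  refine Continuous.div ?_ ?_ p.denom_ne_zero
  · exact (continuous_const.mul continuous_subtype_val).add continuous_const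
  · exact (continuous_const.mul continuous_subtype_val).add continuous_const

noncomputable def toHomeomorph (p : MobCoeff) : Circle ≃ₜ Circle where
  toFun := p.toFun
  invFun := p.inv.toFun
  left_inv := p.toFun_inv_left
  right_inv z := by
    have h := p.inv.toFun_inv_left z
    rwa [inv_inv] at h
  continuous_toFun := p.continuous_toFun
  continuous_invFun := p.inv.continuous_toFun

end MobCoeff

/-- The Möbius group, as a group of transformations of the circle. -/
noncomputable def Mob : Subgroup (Circle ≃ₜ Circle) where
  carrier := Set.range MobCoeff.toHomeomorph
  mul_mem' := by
    rintro _ _ ⟨p, rfl⟩ ⟨q, rfl⟩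
    exact ⟨p.mul q, Homeomorph.ext fun z => p.toFun_mul q z⟩
  one_mem' := by
    refine ⟨⟨1, 0, by simp⟩, Homeomorph.ext fun z => Circle.ext ?_⟩
    change (MobCoeff.toFun _ z : ℂ) = (z : ℂ)
    simp [MobCoeff.coe_toFun]
  inv_mem' := by
    rintro _ ⟨p, rfl⟩
    exact ⟨p.inv, Homeomorph.ext fun _ => rfl⟩

namespace Mob

/-- The Möbius transformation with given coefficients. -/
noncomputable def ofCoeff (p : MobCoeff) : Mob := ⟨p.toHomeomorph, p, rfl⟩

/-- The Lie group topology of the Möbius group: the quotient topology with respect to the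
surjection `(a, b) ↦ (z ↦ (a z + b) / (b̄ z + ā))`. -/
noncomputable instance : TopologicalSpace Mob := TopologicalSpace.coinduced ofCoeff inferInstance

/-- The anticlockwise rotation `z ↦ e^{iα} z`. -/
noncomputable def rotation (α : ℝ) : Mob :=
  ⟨Homeomorph.mulLeft (Circle.exp α), by
    refine ⟨⟨(Circle.exp (α / 2) : Circle), 0, by rw [Circle.normSq_coe, map_zero, sub_zero]⟩, Homeomorph.ext fun z => Circle.ext ?_⟩
    change (MobCoeff.toFun _ z : ℂ) = ((Circle.exp α * z : Circle) : ℂ)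
    have h : Circle.exp α = Circle.exp (α / 2) * Circle.exp (α / 2) := by
      rw [← Circle.exp_add, add_halves]
    rw [MobCoeff.coe_toFun, h]
    simp only [map_zero, add_zero, zero_mul, zero_add, Circle.coe_mul]
    rw [← Circle.coe_inv_eq_conj, Circle.coe_inv, div_inv_eq_mul]
    ring⟩

end Mob

/-! ### Intervals of the circle -/

/-- The open, nonempty, nondense intervals (arcs) of the circle. -/
structure CircleInterval where
  carrier : Set Circle
  isOpen : IsOpen carrier
  isConnected : IsConnected carrier
  not_dense : ¬ Dense carrier

namespace CircleInterval

/-- The image `φ(I)` of an interval under a Möbius transformation. -/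
def map (φ : Mob) (I : CircleInterval) : CircleInterval where
  carrier := φ.1 '' I.carrier
  isOpen := φ.1.isOpenMap _ I.isOpen
  isConnected := I.isConnected.image _ φ.1.continuous.continuousOn
  not_dense h := I.not_dense (by
    have h' := h.preimage φ.1.isOpenMap
    rwa [φ.1.injective.preimage_image] at h')

end CircleInterval

/-! ### Generators of one-parameter unitary groups -/

section Generator

variable {H : Type*} [NormedAddCommGroup H] [InnerProductSpace ℂ H]

/-- The generator `L` of a one-parameter group `V α = e^{iαL}`: its domain consists of the vectors
`v` such that `α ↦ V α v` is differentiable at `0`, and `L v = -i (d/dα) V α v` at `α = 0`. -/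
noncomputable def oneParamGenerator (V : ℝ → H →L[ℂ] H) : H →ₗ.[ℂ] H where
  domain :=
    { carrier := {v | DifferentiableAt ℝ (fun α => V α v) 0}
      add_mem' := fun {v w} hv hw => by
        simpa only [Set.mem_ofPred_eq, map_add] using! hv.add hw
      zero_mem' := by simp
      smul_mem' := fun c v hv => by
        simpa only [Set.mem_ofPred_eq, map_smul] using! hv.const_smul c }
  toFun :=
    { toFun := fun v => (-Complex.I) • deriv (fun α => V α (v : H)) 0
      map_add' := fun v w => by
        rw [← smul_add, ← deriv_fun_add v.2 w.2]
        simp only [Submodule.coe_add, map_add]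
      map_smul' := fun c v => by
        simp only [Submodule.coe_smul, map_smul, RingHom.id_apply]
        rw [deriv_fun_const_smul c v.2, smul_comm] }

/-- The eigenspace of an unbounded operator. -/
def LinearPMap.eigenspace (T : H →ₗ.[ℂ] H) (μ : ℂ) : Submodule ℂ H where
  carrier := {v | ∃ hv : v ∈ T.domain, T ⟨v, hv⟩ = μ • v}
  add_mem' := by
    rintro v w ⟨hv, ev⟩ ⟨hw, ew⟩
    refine ⟨T.domain.add_mem hv hw, ?_⟩
    rw [smul_add, ← ev, ← ew, ← T.map_add]
    rfl
  zero_mem' := ⟨T.domain.zero_mem, by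
    rw [smul_zero]
    exact T.map_zero⟩
  smul_mem' := by
    rintro c v ⟨hv, ev⟩
    refine ⟨T.domain.smul_mem c hv, ?_⟩
    rw [smul_comm, ← ev, ← T.map_smul]
    rfl

variable [CompleteSpace H]

/-- The orthogonal projection onto the (closure of the) eigenspace of an unbounded operator. For a
closed operator, in particular for a self-adjoint one, the eigenspace is already closed. -/
noncomputable def LinearPMap.eigenproj (T : H →ₗ.[ℂ] H) (μ : ℂ) : H →L[ℂ] H :=
  (T.eigenspace μ).topologicalClosure.starProjection

/-- The power `T ^ k`, for real `k > 0`, of a self-adjoint operator `T` with `Sp T ⊆ ℕ`, given by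
the functional calculus: such a `T` has the spectral resolution `T = ∑ n E_n`, where `E_n` is the
orthogonal projection onto the eigenspace of `n`, and `T ^ k = ∑ n ^ k E_n` on the domain of all
vectors for which this (orthogonal) series converges. -/
noncomputable def LinearPMap.natSpectrumPow (T : H →ₗ.[ℂ] H) (k : ℝ) : H →ₗ.[ℂ] H where
  domain :=
    { carrier := {v | Summable fun n : ℕ => (((n : ℝ) ^ k : ℝ) : ℂ) • T.eigenproj n v}
      add_mem' := fun {v w} hv hw => by
        simpa only [Set.mem_ofPred_eq, (T.eigenproj _).map_add, smul_add] using! Summable.add hv hw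
      zero_mem' := by simp
      smul_mem' := fun c v hv => by
        simpa only [Set.mem_ofPred_eq, (T.eigenproj _).map_smul, smul_comm _ c] using!
          Summable.const_smul c hv }
  toFun :=
    { toFun := fun v => ∑' n : ℕ, (((n : ℝ) ^ k : ℝ) : ℂ) • T.eigenproj n (v : H)
      map_add' := fun v w => by
        rw [← Summable.tsum_add v.2 w.2]
        simp only [Submodule.coe_add, (T.eigenproj _).map_add, smul_add]
      map_smul' := fun c v => by
        simp only [Submodule.coe_smul, (T.eigenproj _).map_smul, RingHom.id_apply]
        rw [← Summable.tsum_const_smul c v.2]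
        simp only [smul_comm _ c] }

end Generator

/-! ### Möbius covariant local nets -/

/-- A Möbius covariant local net `(𝒜, U)` of von Neumann algebras on the circle, acting on the
Hilbert space `H`, together with its vacuum vector `Ω` (which is unique up to phase). -/
structure MobiusCovariantNet (H : Type*) [NormedAddCommGroup H] [InnerProductSpace ℂ H]
    [CompleteSpace H] where
  /-- The local algebras. -/
  alg : CircleInterval → VonNeumannAlgebra H
  /-- The unitary representation of the Möbius group. -/
  U : Mob →* unitary (H →L[ℂ] H)
  /-- The vacuum vector. -/
  Ω : H
  strongly_continuous : ∀ v : H, Continuous fun φ : Mob => (U φ : H →L[ℂ] H) v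
  isotony : ∀ I₁ I₂ : CircleInterval, I₁.carrier ⊆ I₂.carrier → alg I₁ ≤ alg I₂
  locality : ∀ I₁ I₂ : CircleInterval, I₁.carrier ∩ I₂.carrier = ∅ →
    ∀ S ∈ alg I₁, ∀ T ∈ alg I₂, S * T = T * S
  covariance : ∀ (φ : Mob) (I : CircleInterval),
    (fun T : H →L[ℂ] H => (U φ : H →L[ℂ] H) * T * ((U φ)⁻¹ : unitary (H →L[ℂ] H))) ''
      (alg I : Set (H →L[ℂ] H)) = (alg (I.map φ) : Set (H →L[ℂ] H))
  positivity : ∀ v : (oneParamGenerator fun α => (U (Mob.rotation α) : H →L[ℂ] H)).domain,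
    0 ≤ (inner ℂ (v : H) (oneParamGenerator (fun α => (U (Mob.rotation α) : H →L[ℂ] H)) v)).re
  vacuum_norm : ‖Ω‖ = 1
  vacuum_invariant : ∀ φ : Mob, (U φ : H →L[ℂ] H) Ω = Ω
  vacuum_unique : ∀ v : H, ‖v‖ = 1 → (∀ φ : Mob, (U φ : H →L[ℂ] H) v = v) →
    ∃ c : Circle, v = (c : ℂ) • Ω
  vacuum_cyclic : Dense {v : H | ∃ T ∈ Set.centralizer (Set.centralizer
    (⋃ I : CircleInterval, (alg I : Set (H →L[ℂ] H)))), v = T Ω}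

namespace MobiusCovariantNet

variable {H : Type*} [NormedAddCommGroup H] [InnerProductSpace ℂ H] [CompleteSpace H]

/-- The conformal Hamiltonian `L₀`, defined by `U(ρ_α) = e^{iαL₀}`. -/
noncomputable def L₀ (N : MobiusCovariantNet H) : H →ₗ.[ℂ] H :=
  oneParamGenerator fun α => (N.U (Mob.rotation α) : H →L[ℂ] H)

/-- The power `L₀ ^ k` of the conformal Hamiltonian; recall that `Sp(L₀) ⊆ ℕ`, since `L₀` is
positive and `e^{2πiL₀} = 1`. -/
noncomputable def L₀pow (N : MobiusCovariantNet H) (k : ℝ) : H →ₗ.[ℂ] H :=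
  N.L₀.natSpectrumPow k

/-- The conjugates `U(ρ_α) T U(ρ_α)*`. -/
noncomputable def rotated (N : MobiusCovariantNet H) (T : H →L[ℂ] H) (α : ℝ) : H →L[ℂ] H :=
  (N.U (Mob.rotation α) : H →L[ℂ] H) * T * star (N.U (Mob.rotation α) : H →L[ℂ] H)

/-- The star-algebra `𝒜^∞(I)` of the elements of `𝒜(I)` which are smooth, in operator norm, with
respect to the rotations. -/
noncomputable def smoothAlg (N : MobiusCovariantNet H) (I : CircleInterval) :
    StarSubalgebra ℂ (H →L[ℂ] H) where
  carrier := {T | T ∈ N.alg I ∧ ContDiff ℝ ∞ (N.rotated T)}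
  mul_mem' := by
    rintro S T ⟨hS, sS⟩ ⟨hT, sT⟩
    refine ⟨mul_mem hS hT, ?_⟩
    have h : N.rotated (S * T) = fun α => N.rotated S α * N.rotated T α := by
      funext α
      have hu : star (N.U (Mob.rotation α) : H →L[ℂ] H) * (N.U (Mob.rotation α) : H →L[ℂ] H) = 1 :=
        Unitary.coe_star_mul_self _
      simp only [rotated]
      rw [mul_assoc _ _ (_ * T * _), ← mul_assoc (star _) (_ * T), ← mul_assoc (star _) _ T, hu,
        one_mul]
      simp only [mul_assoc]
    rw [h]
    exact sS.mul sT
  add_mem' := by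
    rintro S T ⟨hS, sS⟩ ⟨hT, sT⟩
    refine ⟨add_mem hS hT, ?_⟩
    have h : N.rotated (S + T) = fun α => N.rotated S α + N.rotated T α := by
      funext α
      simp only [rotated, mul_add, add_mul]
    rw [h]
    exact sS.add sT
  algebraMap_mem' := fun c => by
    refine ⟨(N.alg I).toStarSubalgebra.algebraMap_mem c, ?_⟩
    have h : N.rotated (algebraMap ℂ (H →L[ℂ] H) c) = fun _ => algebraMap ℂ (H →L[ℂ] H) c := by
      funext α
      simp only [rotated]
      have hu : (N.U (Mob.rotation α) : H →L[ℂ] H) * star (N.U (Mob.rotation α) : H →L[ℂ] H) = 1 :=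
        Unitary.coe_mul_star_self _
      rw [← Algebra.commutes, mul_assoc, hu, mul_one]
    rw [h]
    exact contDiff_const
  star_mem' := by
    rintro T ⟨hT, sT⟩
    refine ⟨star_mem hT, ?_⟩
    have h : N.rotated (star T) = fun α => star (N.rotated T α) := by
      funext α
      simp only [rotated, star_mul, star_star, mul_assoc]
    rw [h]
    exact ((starL' ℝ : (H →L[ℂ] H) ≃L[ℝ] (H →L[ℂ] H)).contDiff).comp sT

/-- The subspace `𝒜^∞(I)Ω`. -/
noncomputable def smoothVacuumSpace (N : MobiusCovariantNet H) (I : CircleInterval) :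
    Submodule ℂ H where
  carrier := {v | ∃ T ∈ N.smoothAlg I, v = T N.Ω}
  add_mem' := by
    rintro _ _ ⟨S, hS, rfl⟩ ⟨T, hT, rfl⟩
    exact ⟨S + T, add_mem hS hT, rfl⟩
  zero_mem' := ⟨0, zero_mem _, rfl⟩
  smul_mem' := by
    rintro c _ ⟨T, hT, rfl⟩
    exact ⟨c • T, (N.smoothAlg I).smul_mem hT c, rfl⟩

end MobiusCovariantNet

/-! ### The spectral resolution of the conformal Hamiltonian

Proved facts which show that the definition of `L₀ ^ k` is the functional calculus of `L₀` in every
Möbius covariant net: the eigenspaces of the eigenvalues `n ∈ ℕ` of `L₀` are total, and the power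
with exponent `1` is `L₀` itself, including its domain. -/

section SpectralResolution

variable {H : Type*} [NormedAddCommGroup H] [InnerProductSpace ℂ H] [CompleteSpace H]

/-- A strongly continuous, `2π`-periodic one-parameter unitary group with positive generator. -/
structure PositiveCircleGroup (V : ℝ → H →L[ℂ] H) : Prop where
  zero : V 0 = 1
  add : ∀ s t v, V (s + t) v = V s (V t v)
  isom : ∀ t v w, inner ℂ (V t v) (V t w) = inner ℂ v w
  cont : ∀ v, Continuous fun t => V t v
  period : V (2 * Real.pi) = 1
  pos : ∀ v : (oneParamGenerator V).domain, 0 ≤ (inner ℂ (v : H) (oneParamGenerator V v)).re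

variable {V : ℝ → H →L[ℂ] H}

theorem oneParamGenerator_apply (v : (oneParamGenerator V).domain) :
    oneParamGenerator V v = (-Complex.I) • deriv (fun α => V α (v : H)) 0 := rfl

theorem PositiveCircleGroup.hasDerivAt (h : PositiveCircleGroup V) (v : (oneParamGenerator V).domain) (t : ℝ) :
    HasDerivAt (fun α => V α (v : H)) (V t (Complex.I • oneParamGenerator V v)) t := by
  have h0 : HasDerivAt (fun α => V α (v : H)) (Complex.I • oneParamGenerator V v) 0 := by
    rw [oneParamGenerator_apply, smul_smul]
    simpa using DifferentiableAt.hasDerivAt v.2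
  have h1 : HasDerivAt (fun α => V (α - t) (v : H)) (Complex.I • oneParamGenerator V v) t := by
    have h0' : HasDerivAt (fun α => V α (v : H)) (Complex.I • oneParamGenerator V v) (t - t) := by
      simpa using h0
    simpa using! h0'.comp_sub_const t t
  have h2 := ((V t).restrictScalars ℝ).hasFDerivAt.comp_hasDerivAt t h1
  refine h2.congr_of_eventuallyEq (Filter.Eventually.of_forall fun α => ?_)
  change _ = V t (V (α - t) v)
  rw [← h.add]; simp

theorem oneParamGenerator_of_hasDerivAt {v u : H} (hd : HasDerivAt (fun α => V α v) (Complex.I • u) 0) :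
    ∃ hv : v ∈ (oneParamGenerator V).domain, oneParamGenerator V ⟨v, hv⟩ = u := by
  refine ⟨hd.differentiableAt, ?_⟩
  rw [oneParamGenerator_apply, hd.deriv, smul_smul]; simp

theorem hasDerivAt_cexp_mul_ofReal (μ : ℂ) (t : ℝ) :
    HasDerivAt (fun α : ℝ => Complex.exp (μ * α)) (μ * Complex.exp (μ * t)) t := by
  have h1 : HasDerivAt (fun α : ℝ => μ * (α : ℂ)) μ t := by
    simpa using (Complex.ofRealCLM.hasDerivAt (x := t)).const_mul μ
  simpa [mul_comm] using! h1.cexp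

theorem PositiveCircleGroup.mem_eig (h : PositiveCircleGroup V) (μ : ℂ) (v : H) :
    v ∈ (oneParamGenerator V).eigenspace μ ↔
      ∀ t : ℝ, V t v = Complex.exp (Complex.I * μ * t) • v := by
  constructor
  · rintro ⟨hv, e⟩ t
    have hd : ∀ s : ℝ, HasDerivAt (fun α : ℝ => Complex.exp (-(Complex.I * μ) * α) • V α v) 0 s := by
      intro s
      have h1 := h.hasDerivAt ⟨v, hv⟩ s
      have h2 := (hasDerivAt_cexp_mul_ofReal (-(Complex.I * μ)) s).smul h1
      refine h2.congr_deriv ?_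
      rw [e, map_smul, map_smul, smul_smul, smul_smul, ← add_smul]
      convert zero_smul ℂ _ using 2
      ring
    have hc := is_const_of_deriv_eq_zero (fun s => (hd s).differentiableAt) (fun s => (hd s).deriv) t 0
    simp only [h.zero, Complex.ofReal_zero, mul_zero, Complex.exp_zero, one_smul] at hc
    change _ = v at hc
    conv_rhs => rw [← hc]
    rw [smul_smul, ← Complex.exp_add]
    simp
  · intro hv
    have := (hasDerivAt_cexp_mul_ofReal (Complex.I * μ) 0).smul_const v
    have h2 : HasDerivAt (fun α => V α v) (Complex.I • (μ • v)) 0 := by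
      simp_rw [hv]
      simpa [smul_smul] using this
    exact oneParamGenerator_of_hasDerivAt h2

theorem PositiveCircleGroup.isClosed_eig (h : PositiveCircleGroup V) (μ : ℂ) :
    IsClosed ((oneParamGenerator V).eigenspace μ : Set H) := by
  have : ((oneParamGenerator V).eigenspace μ : Set H) =
      ⋂ t : ℝ, {v | V t v = Complex.exp (Complex.I * μ * t) • v} := by
    ext v; simp [h.mem_eig]
  rw [this]
  exact isClosed_iInter fun t => isClosed_eq (V t).continuous (continuous_const_smul _)

theorem PositiveCircleGroup.closure_eig (h : PositiveCircleGroup V) (μ : ℂ) :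
    ((oneParamGenerator V).eigenspace μ).topologicalClosure = (oneParamGenerator V).eigenspace μ :=
  (h.isClosed_eig μ).submodule_topologicalClosure_eq

theorem PositiveCircleGroup.eigenproj_mem (h : PositiveCircleGroup V) (μ : ℂ) (v : H) :
    (oneParamGenerator V).eigenproj μ v ∈ (oneParamGenerator V).eigenspace μ := by
  rw [← h.closure_eig μ]
  exact Submodule.starProjection_apply_mem _ v

theorem PositiveCircleGroup.neg_eig (h : PositiveCircleGroup V) (n : ℤ) (hn : n < 0) (v : H)
    (hv : v ∈ (oneParamGenerator V).eigenspace n) : v = 0 := by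
  obtain ⟨hd, e⟩ := hv
  have := h.pos ⟨v, hd⟩
  rw [e, inner_smul_right, inner_self_eq_norm_sq_to_K] at this
  have h2 : ((n : ℂ) * ((‖v‖ : ℝ) : ℂ) ^ 2).re = (n : ℝ) * ‖v‖ ^ 2 := by norm_cast
  have h3 : (n : ℝ) < 0 := by exact_mod_cast hn
  have h4 : 0 ≤ (n : ℝ) * ‖v‖ ^ 2 := by rw [← h2]; exact this
  by_contra h0
  have : 0 < ‖v‖ ^ 2 := by positivity
  nlinarith

theorem PositiveCircleGroup.fourier_mem (h : PositiveCircleGroup V) (n : ℤ) (v : H) :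
    (∫ t in (0:ℝ)..(2 * Real.pi), Complex.exp (-(Complex.I * n) * t) • V t v) ∈
      (oneParamGenerator V).eigenspace n := by
  rw [h.mem_eig]
  intro s
  set g : ℝ → H := fun t => Complex.exp (-(Complex.I * n) * t) • V t v with hg
  have hgc : Continuous g := by
    refine Continuous.smul (by fun_prop) (h.cont v)
  have hper : Function.Periodic g (2 * Real.pi) := by
    intro t
    simp only [hg]
    rw [h.add, h.period]
    congr 1
    push_cast
    rw [mul_add, Complex.exp_add]
    have : Complex.exp (-(Complex.I * n) * (2 * Real.pi)) = 1 := by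
      rw [Complex.exp_eq_one_iff]; exact ⟨-n, by push_cast; ring⟩
    rw [this, mul_one]
  rw [← ContinuousLinearMap.intervalIntegral_comp_comm _ (hgc.intervalIntegrable _ _)]
  have h1 : ∀ t, V s (g t) = Complex.exp (Complex.I * n * s) • g (t + s) := by
    intro t
    simp only [hg]
    rw [map_smul, ← h.add, smul_smul, ← Complex.exp_add, add_comm s t]
    congr 2
    push_cast; ring
  simp_rw [h1]
  rw [intervalIntegral.integral_smul, intervalIntegral.integral_comp_add_right]
  congr 1
  have := hper.intervalIntegral_add_eq s 0
  rw [zero_add] at this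
  rw [zero_add, add_comm _ s]
  exact this

theorem PositiveCircleGroup.total (h : PositiveCircleGroup V) (w : H)
    (hw : ∀ n : ℕ, ∀ v ∈ (oneParamGenerator V).eigenspace n, inner ℂ w v = 0) : w = 0 := by
  have : Fact (0 < 2 * Real.pi) := ⟨Real.two_pi_pos⟩
  have hper : Function.Periodic (fun t => inner ℂ w (V t w)) (2 * Real.pi) := by
    intro t
    simp only
    rw [h.add, h.period]; rfl
  have hcont : Continuous (fun t => inner ℂ w (V t w)) := continuous_const.inner (h.cont w)
  let f : C(AddCircle (2 * Real.pi), ℂ) :=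
    ⟨hper.lift, continuous_coinduced_dom.mpr (by exact hcont)⟩
  have hf : ∀ t : ℝ, f t = inner ℂ w (V t w) := fun t => hper.lift_coe t
  have hco : ∀ n, fourierCoeff f n = 0 := by
    intro n
    rw [fourierCoeff_eq_intervalIntegral f n 0]
    have hm := h.fourier_mem n w
    have h0 : inner ℂ w (∫ t in (0:ℝ)..(2 * Real.pi),
        Complex.exp (-(Complex.I * n) * t) • V t w) = 0 := by
      rcases lt_or_ge n 0 with hn | hn
      · rw [h.neg_eig n hn _ hm, inner_zero_right]
      · lift n to ℕ using hn
        exact hw n _ (by exact_mod_cast hm)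
    have hint : IntervalIntegrable (fun t : ℝ => Complex.exp (-(Complex.I * n) * t) • V t w)
        MeasureTheory.volume 0 (2 * Real.pi) :=
      (Continuous.smul (by fun_prop) (h.cont w)).intervalIntegrable _ _
    have h1 := (innerSL ℂ w).intervalIntegral_comp_comm hint
    simp only [innerSL_apply_apply] at h1
    rw [h0] at h1
    rw [zero_add]
    convert smul_zero _ using 2
    rw [← h1]
    refine intervalIntegral.integral_congr fun t _ => ?_
    rw [hf, inner_smul_right, smul_eq_mul, fourier_coe_apply]
    congr 2
    push_cast
    have : (Real.pi : ℂ) ≠ 0 := by exact_mod_cast Real.pi_ne_zero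
    field_simp
  have hs := has_pointwise_sum_fourier_series_of_summable (f := f)
    (by simp [funext hco]) ((0 : ℝ) : AddCircle (2 * Real.pi))
  simp only [hco, zero_smul] at hs
  have := hs.unique hasSum_zero
  rw [hf, h.zero] at this
  exact inner_self_eq_zero.mp this

theorem PositiveCircleGroup.eig_orth (h : PositiveCircleGroup V) {m n : ℕ} (hmn : m ≠ n) {v w : H}
    (hv : v ∈ (oneParamGenerator V).eigenspace m) (hw : w ∈ (oneParamGenerator V).eigenspace n) :
    inner ℂ v w = 0 := by
  rw [h.mem_eig] at hv hw
  by_contra h0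
  have key : ∀ t : ℝ, Complex.exp (Complex.I * ((n : ℂ) - m) * t) = 1 := by
    intro t
    have := h.isom t v w
    rw [hv, hw, inner_smul_left, inner_smul_right, ← Complex.exp_conj, ← mul_assoc,
      ← Complex.exp_add] at this
    have h2 := mul_right_cancel₀ h0 (this.trans (one_mul _).symm)
    rw [← h2]; congr 1
    simp; ring
  have hd := hasDerivAt_cexp_mul_ofReal (Complex.I * ((n : ℂ) - m)) 0
  simp_rw [key] at hd
  have := hd.unique (hasDerivAt_const (0:ℝ) (1:ℂ))
  simp [sub_eq_zero] at this
  exact hmn (this.symm)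

theorem PositiveCircleGroup.eigenproj_of_mem (h : PositiveCircleGroup V) {n : ℕ} (m : ℕ) {v : H}
    (hv : v ∈ (oneParamGenerator V).eigenspace n) :
    (oneParamGenerator V).eigenproj m v = if m = n then v else 0 := by
  split_ifs with hmn
  · subst hmn
    exact Submodule.starProjection_eq_self_iff.mpr (by rwa [h.closure_eig])
  · refine (Submodule.starProjection_apply_eq_zero_iff _).mpr ?_
    rw [h.closure_eig]
    exact fun u hu => h.eig_orth hmn hu hv

/-- `∑ E_n = 1`. -/
theorem PositiveCircleGroup.hasSum (h : PositiveCircleGroup V) (v : H) :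
    HasSum (fun n : ℕ => (oneParamGenerator V).eigenproj n v) v := by
  set K : ℕ → Submodule ℂ H := fun n => (oneParamGenerator V).eigenspace n with hK
  have : ∀ n, CompleteSpace (K n) := fun n => (h.isClosed_eig n).completeSpace_coe
  have hS : IsHilbertSum ℂ (fun n => K n) fun n => (K n).subtypeₗᵢ := by
    refine IsHilbertSum.mkInternal _ ?_ ?_
    · intro m n hmn v w
      exact h.eig_orth hmn v.2 w.2
    · rw [top_le_iff, Submodule.topologicalClosure_eq_top_iff, Submodule.eq_bot_iff]
      intro w hw
      refine h.total w fun n v hv => ?_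
      rw [← inner_conj_symm, hw v (Submodule.mem_iSup_of_mem n hv), map_zero]
  have hs := hS.hasSum_linearIsometryEquiv_symm (hS.linearIsometryEquiv v)
  rw [LinearIsometryEquiv.symm_apply_apply] at hs
  convert hs using 1
  funext m
  have h1 := hs.mapL ((oneParamGenerator V).eigenproj m)
  refine h1.unique ?_
  have h2 : ∀ n, (oneParamGenerator V).eigenproj m ((K n).subtypeₗᵢ (hS.linearIsometryEquiv v n)) =
      if n = m then ((K m).subtypeₗᵢ (hS.linearIsometryEquiv v m)) else 0 := by
    intro n
    refine (h.eigenproj_of_mem m (hS.linearIsometryEquiv v n).2).trans ?_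
    split_ifs with h1 h2 h2
    · subst h1; rfl
    · exact absurd h1.symm h2
    · exact absurd h2.symm h1
    · rfl
  simp_rw [h2]
  exact hasSum_ite_eq m _

theorem PositiveCircleGroup.eigenproj_V (h : PositiveCircleGroup V) (n : ℕ) (t : ℝ) (v : H) :
    (oneParamGenerator V).eigenproj n (V t v) =
      Complex.exp (Complex.I * n * t) • (oneParamGenerator V).eigenproj n v := by
  have h1 := ((h.hasSum v).mapL (V t)).mapL ((oneParamGenerator V).eigenproj n)
  refine h1.unique ?_
  have h2 : ∀ m : ℕ, (oneParamGenerator V).eigenproj n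
      (V t ((oneParamGenerator V).eigenproj m v)) = if m = n then
      Complex.exp (Complex.I * n * t) • (oneParamGenerator V).eigenproj n v else 0 := by
    intro m
    rw [(h.mem_eig _ _).mp (h.eigenproj_mem m v) t, map_smul,
      h.eigenproj_of_mem n (h.eigenproj_mem m v)]
    split_ifs with h1 h2 h2
    · rw [h1]
    · exact absurd h1.symm h2
    · exact absurd h2.symm h1
    · simp
  simp_rw [h2]
  exact hasSum_ite_eq n _

theorem PositiveCircleGroup.eq_of_proj (h : PositiveCircleGroup V) {v w : H}
    (e : ∀ n : ℕ, (oneParamGenerator V).eigenproj n v = (oneParamGenerator V).eigenproj n w) :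
    v = w := by
  have := h.hasSum v
  simp_rw [e] at this
  exact this.unique (h.hasSum w)

theorem PositiveCircleGroup.gen_iff (h : PositiveCircleGroup V) (v u : H) :
    (∃ hv : v ∈ (oneParamGenerator V).domain, oneParamGenerator V ⟨v, hv⟩ = u) ↔
      ∀ n : ℕ, (oneParamGenerator V).eigenproj n u =
        (n : ℂ) • (oneParamGenerator V).eigenproj n v := by
  constructor
  · rintro ⟨hv, e⟩ n
    have h1 := h.hasDerivAt ⟨v, hv⟩ 0
    rw [e, h.zero] at h1
    have h2 := (((oneParamGenerator V).eigenproj n).restrictScalars ℝ).hasFDerivAt.comp_hasDerivAt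
      0 h1
    have h3 : HasDerivAt (fun t : ℝ => (oneParamGenerator V).eigenproj n (V t v))
      ((oneParamGenerator V).eigenproj n (Complex.I • u)) 0 := h2
    simp_rw [h.eigenproj_V] at h3
    have h4 := h3.unique ((hasDerivAt_cexp_mul_ofReal (Complex.I * n) 0).smul_const _)
    rw [map_smul] at h4
    simp only [Complex.ofReal_zero, mul_zero, Complex.exp_zero, mul_one, mul_smul] at h4
    exact smul_right_injective H Complex.I_ne_zero h4
  · intro e
    refine oneParamGenerator_of_hasDerivAt ?_
    have hc : Continuous fun s => V s (Complex.I • u) := h.cont _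
    have hV : ∀ t, V t v = v + ∫ s in (0:ℝ)..t, V s (Complex.I • u) := by
      intro t
      refine h.eq_of_proj fun n => ?_
      rw [map_add, ← ContinuousLinearMap.intervalIntegral_comp_comm _ (hc.intervalIntegrable _ _)]
      simp_rw [h.eigenproj_V, map_smul, e]
      have hder : ∀ s ∈ Set.uIcc (0:ℝ) t, HasDerivAt
          (fun s : ℝ => Complex.exp (Complex.I * n * s) • (oneParamGenerator V).eigenproj n v)
          (Complex.exp (Complex.I * n * s) • Complex.I • (n : ℂ) • 
            (oneParamGenerator V).eigenproj n v) s := by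
        intro s _
        refine ((hasDerivAt_cexp_mul_ofReal (Complex.I * n) s).smul_const _).congr_deriv ?_
        simp only [smul_smul]
        congr 1; ring
      rw [intervalIntegral.integral_eq_sub_of_hasDerivAt hder
        (Continuous.intervalIntegrable (by fun_prop) _ _)]
      simp
    have h1 := (intervalIntegral.integral_hasDerivAt_right (hc.intervalIntegrable 0 0)
      (hc.stronglyMeasurableAtFilter _ _) hc.continuousAt).const_add v
    rw [h.zero] at h1
    exact h1.congr_of_eventuallyEq (Filter.Eventually.of_forall hV)

theorem PositiveCircleGroup.pow_iff (h : PositiveCircleGroup V) (k : ℝ) (v u : H) :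
    (∃ hv : v ∈ ((oneParamGenerator V).natSpectrumPow k).domain,
      (oneParamGenerator V).natSpectrumPow k ⟨v, hv⟩ = u) ↔
      ∀ n : ℕ, (oneParamGenerator V).eigenproj n u =
        (((n : ℝ) ^ k : ℝ) : ℂ) • (oneParamGenerator V).eigenproj n v := by
  constructor
  · rintro ⟨hv, e⟩ n
    have h1 := Summable.hasSum hv
    change (∑' m : ℕ, (((m : ℝ) ^ k : ℝ) : ℂ) • (oneParamGenerator V).eigenproj m v) = u at e
    rw [e] at h1
    have h2 := h1.mapL ((oneParamGenerator V).eigenproj n)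
    refine h2.unique ?_
    have h2 : ∀ m : ℕ, (oneParamGenerator V).eigenproj n
        ((((m : ℝ) ^ k : ℝ) : ℂ) • (oneParamGenerator V).eigenproj m v) = if m = n then
        (((n : ℝ) ^ k : ℝ) : ℂ) • (oneParamGenerator V).eigenproj n v else 0 := by
      intro m
      rw [map_smul, h.eigenproj_of_mem n (h.eigenproj_mem m v)]
      split_ifs with h1 h2 h2
      · rw [h1]
      · exact absurd h1.symm h2
      · exact absurd h2.symm h1
      · simp
    simp_rw [h2]
    exact hasSum_ite_eq n _
  · intro e
    have := h.hasSum u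
    simp_rw [e] at this
    exact ⟨this.summable, this.tsum_eq⟩

theorem PositiveCircleGroup.pow_one (h : PositiveCircleGroup V) :
    (oneParamGenerator V).natSpectrumPow 1 = oneParamGenerator V := by
  refine LinearPMap.eq_of_eq_graph ?_
  ext ⟨v, u⟩
  rw [LinearPMap.mem_graph_iff, LinearPMap.mem_graph_iff]
  have := (h.pow_iff 1 v u).trans (by simpa using (h.gen_iff v u).symm)
  constructor
  · rintro ⟨⟨y, hy⟩, rfl, rfl⟩
    obtain ⟨hv, e⟩ := this.mp ⟨hy, rfl⟩
    exact ⟨⟨_, hv⟩, rfl, e⟩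
  · rintro ⟨⟨y, hy⟩, rfl, rfl⟩
    obtain ⟨hv, e⟩ := this.mpr ⟨hy, rfl⟩
    exact ⟨⟨_, hv⟩, rfl, e⟩

theorem Mob.continuous_rotation : Continuous Mob.rotation := by
  have : Mob.rotation = fun α => Mob.ofCoeff
      ⟨(Circle.exp (α / 2) : Circle), 0, by rw [Circle.normSq_coe, map_zero, sub_zero]⟩ := by
    funext α
    apply Subtype.ext
    refine Homeomorph.ext fun z => Circle.ext ?_
    change ((Circle.exp α * z : Circle) : ℂ) = (MobCoeff.toFun _ z : ℂ)
    have h : Circle.exp α = Circle.exp (α / 2) * Circle.exp (α / 2) := by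
      rw [← Circle.exp_add, add_halves]
    rw [MobCoeff.coe_toFun, h]
    simp only [map_zero, add_zero, zero_mul, zero_add, Circle.coe_mul]
    rw [← Circle.coe_inv_eq_conj, Circle.coe_inv, div_inv_eq_mul]
    ring
  rw [this]
  have hc : Continuous Mob.ofCoeff := continuous_coinduced_rng
  refine hc.comp (continuous_induced_rng.mpr ?_)
  change Continuous fun α : ℝ => (((Circle.exp (α / 2) : Circle) : ℂ), (0 : ℂ))
  fun_prop

theorem MobiusCovariantNet.positiveCircleGroup (N : MobiusCovariantNet H) :
    PositiveCircleGroup fun α => (N.U (Mob.rotation α) : H →L[ℂ] H) where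
  zero := by
    have : Mob.rotation 0 = 1 := Subtype.ext (Homeomorph.ext fun z => by
      change Circle.exp 0 * z = z
      simp)
    simp [this]
  add s t v := by
    have : Mob.rotation (s + t) = Mob.rotation s * Mob.rotation t :=
      Subtype.ext (Homeomorph.ext fun z => by
        change Circle.exp (s + t) * z = Circle.exp s * (Circle.exp t * z)
        rw [Circle.exp_add, mul_assoc])
    simp [this]
  isom t v w := ContinuousLinearMap.inner_map_map_of_mem_unitary (N.U _).2 v w
  cont v := (N.strongly_continuous v).comp Mob.continuous_rotation
  period := by
    have : Mob.rotation (2 * Real.pi) = 1 := Subtype.ext (Homeomorph.ext fun z => by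
      change Circle.exp (2 * Real.pi) * z = z
      simp)
    simp [this]
  pos := N.positivity

theorem MobiusCovariantNet.hasSum_eigenproj (N : MobiusCovariantNet H) (v : H) :
    HasSum (fun n : ℕ => N.L₀.eigenproj n v) v :=
  N.positiveCircleGroup.hasSum v

theorem MobiusCovariantNet.L₀pow_one (N : MobiusCovariantNet H) : N.L₀pow 1 = N.L₀ := N.positiveCircleGroup.pow_one

end SpectralResolution

/-! ### Power series vanishing on an arc of the unit circle -/

/-! Write `V t = e^{itL₀}` and let `E_n` be its spectral projections. Because the spectrum lies in
`ℕ`, a matrix coefficient `⟨w, V t v⟩ = ∑ ⟨w, E_n v⟩ e^{int}` is the boundary value of a power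
series with summable coefficients. If it vanishes on an arc, all its coefficients vanish
(`eq_zero_of_tsum_mul_exp_eq_zero`).

This yields a local criterion for cores, `PositiveCircleGroup.hasCore_pow`: full invariance of `D`
under `V` is not needed, only a dense `D₀` with `V t D₀ ⊆ D` for small `t`. A pair `(a, b)`
annihilating the graph of `L₀^k` over `D` satisfies `⟨a, V t v⟩ + ⟨b, V t L₀^k v⟩ = 0` for `v ∈ D₀`
and small `t`. Hence `⟨E_n a + n^k E_n b, v⟩ = 0` for all `n`, so `E_n a + n^k E_n b = 0` by
density, and `(a, b)` annihilates the whole graph.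

The criterion is applied with `D = 𝒜^∞(I)Ω` and `D₀ = 𝒜^∞(I₀)Ω`, where the closure of `I₀` lies in
`I`, so that small rotations keep `I₀` inside `I`. Density of `D₀` (`dense_smoothVacuumSpace`)
combines the Reeh-Schlieder theorem (`dense_localVacuumSpace`), which rests on the same vanishing
principle for conjugated rotation groups, with smoothing of local operators along rotations. -/

theorem exists_abs_sub_natCast_mul_lt {δ : ℝ} (hδ : 0 < δ) :
    ∃ M : ℕ, ∀ z : ℂ, ‖z‖ = 1 → ∃ j < M, ∃ t : ℝ, |t| < δ ∧
      Complex.exp (-(Complex.I * (j * δ : ℝ))) * z = Complex.exp (Complex.I * t) := by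
  -- For `z` of angle `θ ∈ [0, 2π]`, the choice `j = ⌊θ / δ⌋` leaves a remainder in `[0, δ)`; the
  -- bound on `j` depends only on `θ ≤ 2π`.
  refine ⟨⌊2 * Real.pi / δ⌋₊ + 1, fun z hz => ?_⟩
  obtain ⟨θ, h0, h1, rfl⟩ : ∃ θ : ℝ, 0 ≤ θ ∧ θ ≤ 2 * Real.pi ∧
      Complex.exp (Complex.I * θ) = z := by
    obtain ⟨s, rfl⟩ := (Complex.norm_eq_one_iff z).mp hz
    refine ⟨toIcoMod Real.two_pi_pos 0 s, (toIcoMod_mem_Ico' _ s).1,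
      (toIcoMod_mem_Ico' Real.two_pi_pos s).2.le, ?_⟩
    rw [toIcoMod, mul_comm (s : ℂ), Complex.exp_eq_exp_iff_exists_int]
    exact ⟨-toIcoDiv Real.two_pi_pos 0 s, by push_cast [zsmul_eq_mul]; ring⟩
  have hq : 0 ≤ θ / δ := by positivity
  refine ⟨⌊θ / δ⌋₊, ?_, θ - ⌊θ / δ⌋₊ * δ, ?_, ?_⟩
  · exact Nat.lt_succ_of_le (Nat.floor_le_floor (by gcongr))
  · have h2 := Nat.floor_le hq
    have h3 := Nat.lt_floor_add_one (θ / δ)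
    rw [le_div_iff₀ hδ] at h2
    rw [div_lt_iff₀ hδ] at h3
    rw [abs_lt]
    constructor <;> linarith
  · rw [← Complex.exp_add]
    congr 1
    push_cast
    ring

theorem continuousOn_tsum_mul_pow {c : ℕ → ℂ} (hc : Summable fun n => ‖c n‖) :
    ContinuousOn (fun z : ℂ => ∑' n, c n * z ^ n) (Metric.closedBall 0 1) := by
  refine continuousOn_tsum (fun n => by fun_prop) hc fun n z hz => ?_
  rw [mem_closedBall_zero_iff] at hz
  rw [norm_mul, norm_pow]
  exact mul_le_of_le_one_right (norm_nonneg _) (pow_le_one₀ (norm_nonneg _) hz)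

theorem differentiableOn_tsum_mul_pow {c : ℕ → ℂ} (hc : Summable fun n => ‖c n‖) :
    DifferentiableOn ℂ (fun z : ℂ => ∑' n, c n * z ^ n) (Metric.ball 0 1) := by
  refine Complex.differentiableOn_tsum_of_summable_norm hc (fun n => by fun_prop)
    Metric.isOpen_ball fun n z hz => ?_
  rw [mem_ball_zero_iff] at hz
  rw [norm_mul, norm_pow]
  exact mul_le_of_le_one_right (norm_nonneg _) (pow_le_one₀ (norm_nonneg _) hz.le)

theorem eq_zero_of_eventually_tsum_mul_pow {c : ℕ → ℂ} (hc : Summable fun n => ‖c n‖)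
    (h : ∀ᶠ z in nhds (0 : ℂ), ∑' n, c n * z ^ n = 0) (n : ℕ) : c n = 0 := by
  set p := FormalMultilinearSeries.ofScalars ℂ c with hp
  have hr : 0 < p.radius := by
    refine lt_of_lt_of_le (by simp : (0 : ENNReal) < ((1 : NNReal) : ENNReal))
      (p.le_radius_of_summable_norm ?_)
    refine Summable.of_nonneg_of_le (fun n => by positivity) (fun n => ?_) hc
    simp [hp]
  have h1 := (p.hasFPowerSeriesOnBall hr).hasFPowerSeriesAt
  have h2 : p.sum =ᶠ[nhds 0] 0 := by
    filter_upwards [h] with z hz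
    rw [hp, ← FormalMultilinearSeries.ofScalarsSum, FormalMultilinearSeries.ofScalarsSum_eq_tsum]
    simpa using hz
  have h3 := (h1.congr h2).eq_zero
  have h4 := FormalMultilinearSeries.coeff_ofScalars (𝕜 := ℂ) (p := c) (n := n)
  rw [← hp, h3] at h4
  exact h4.symm

/-- Finitely many rotates of the arc cover the circle, so the product of the corresponding rotates
of `F` vanishes on the whole boundary. The maximum principle makes the product zero in the disc, and
isolation of zeros then forces `F = 0` near `0`. -/
theorem eq_zero_of_tsum_mul_exp_eq_zero {c : ℕ → ℂ} (hc : Summable fun n => ‖c n‖) {ε : ℝ}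
    (hε : 0 < ε) (h : ∀ t : ℝ, |t| < ε → ∑' n, c n * Complex.exp (Complex.I * n * t) = 0)
    (n : ℕ) : c n = 0 := by
  refine eq_zero_of_eventually_tsum_mul_pow hc ?_ n
  set F : ℂ → ℂ := fun z => ∑' n, c n * z ^ n with hF
  obtain ⟨M, hM⟩ := exists_abs_sub_natCast_mul_lt hε
  set r : ℕ → ℂ := fun j => Complex.exp (-(Complex.I * (j * ε : ℝ))) with hr
  have hr1 : ∀ j, ‖r j‖ = 1 := fun j => by
    simp only [hr]
    rw [← mul_neg, mul_comm, ← Complex.ofReal_neg]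
    exact Complex.norm_exp_ofReal_mul_I _
  have hr0 : ∀ j, r j ≠ 0 := fun j => Complex.exp_ne_zero _
  have hmb : ∀ j, Set.MapsTo (fun z => r j * z) (Metric.ball (0 : ℂ) 1) (Metric.ball 0 1) := by
    intro j z hz
    rw [mem_ball_zero_iff] at hz ⊢
    rwa [norm_mul, hr1, one_mul]
  have hmc : ∀ j, Set.MapsTo (fun z => r j * z) (Metric.closedBall (0 : ℂ) 1)
      (Metric.closedBall 0 1) := by
    intro j z hz
    rw [mem_closedBall_zero_iff] at hz ⊢
    rwa [norm_mul, hr1, one_mul]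
  have hd : DiffContOnCl ℂ (fun z => ∏ j ∈ Finset.range M, F (r j * z)) (Metric.ball 0 1) := by
    constructor
    · exact DifferentiableOn.fun_finsetProd fun j _ =>
        (differentiableOn_tsum_mul_pow hc).comp (by fun_prop) (hmb j)
    · rw [closure_ball _ one_ne_zero]
      exact continuousOn_finsetProd _ fun j _ =>
        (continuousOn_tsum_mul_pow hc).comp (by fun_prop) (hmc j)
  have hz : Set.EqOn (fun z => ∏ j ∈ Finset.range M, F (r j * z)) (fun _ => 0)
      (Metric.ball 0 1) := by
    refine Complex.eqOn_of_eqOn_frontier Metric.isBounded_ball hd diffContOnCl_const fun z hz => ?_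
    rw [frontier_ball _ one_ne_zero, mem_sphere_zero_iff_norm] at hz
    obtain ⟨j, hj, t, ht, e⟩ := hM z hz
    refine Finset.prod_eq_zero (Finset.mem_range.mpr hj) ?_
    change F (r j * z) = 0
    rw [hr, e, hF, ← h t ht]
    refine tsum_congr fun n => ?_
    rw [← Complex.exp_nat_mul]
    congr 2
    ring
  have ha : AnalyticAt ℂ F 0 :=
    (differentiableOn_tsum_mul_pow hc).analyticAt (Metric.ball_mem_nhds _ one_pos)
  rcases ha.eventually_eq_zero_or_eventually_ne_zero with h0 | h0
  · exact h0
  · exfalso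
    -- All rotations fix `0`, so if `F` had no zeros in a punctured neighbourhood of `0`, neither
    -- would any rotate, nor their product.
    have h1 : ∀ j, ∀ᶠ z in nhdsWithin (0 : ℂ) {0}ᶜ, F (r j * z) ≠ 0 := by
      intro j
      have ht : Filter.Tendsto (fun z => r j * z) (nhdsWithin (0 : ℂ) {0}ᶜ)
          (nhdsWithin (0 : ℂ) {0}ᶜ) := by
        refine tendsto_nhdsWithin_iff.mpr ⟨?_, ?_⟩
        · have : Continuous fun z => r j * z := by fun_prop
          have h2 := this.tendsto 0
          rw [mul_zero] at h2
          exact h2.mono_left nhdsWithin_le_nhds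
        · filter_upwards [self_mem_nhdsWithin] with z hz
          exact mul_ne_zero (hr0 j) hz
      exact ht.eventually h0
    have h2 : ∀ᶠ z in nhdsWithin (0 : ℂ) {0}ᶜ, ∀ j ∈ Finset.range M, F (r j * z) ≠ 0 :=
      (Filter.eventually_all_finset _).mpr fun j _ => h1 j
    have h3 : ∀ᶠ z in nhdsWithin (0 : ℂ) {0}ᶜ, z ∈ Metric.ball (0 : ℂ) 1 :=
      nhdsWithin_le_nhds (Metric.ball_mem_nhds _ one_pos)
    obtain ⟨z, hz2, hz3⟩ := (h2.and h3).exists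
    exact Finset.prod_ne_zero_iff.mpr hz2 (hz hz3)

/-! ### Cores of powers of positive generators -/

/-- Turns the core property into an inclusion of subspaces of `H × H`, which can be tested by
continuous functionals. -/
theorem LinearPMap.hasCore_of_graph_le {H : Type*} [NormedAddCommGroup H]
    [InnerProductSpace ℂ H] {f : H →ₗ.[ℂ] H} (hf : f.IsClosed) {D : Submodule ℂ H}
    (hD : D ≤ f.domain) (h : f.graph ≤ (f.domRestrict D).graph.topologicalClosure) :
    f.HasCore D := by
  have hle : f.domRestrict D ≤ f := LinearPMap.domRestrict_le
  have hcl : (f.domRestrict D).IsClosable := hf.isClosable.leIsClosable hle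
  refine ⟨hD, LinearPMap.eq_of_eq_graph (le_antisymm ?_ ?_)⟩
  · rw [← hcl.graph_closure_eq_closure_graph]
    exact Submodule.topologicalClosure_minimal _ (LinearPMap.le_graph_of_le hle) hf
  · rwa [← hcl.graph_closure_eq_closure_graph]

section Core

variable {H : Type*} [NormedAddCommGroup H] [InnerProductSpace ℂ H] [CompleteSpace H]
variable {V : ℝ → H →L[ℂ] H}

theorem PositiveCircleGroup.inner_eigenproj (h : PositiveCircleGroup V) (n : ℕ) (v w : H) :
    inner ℂ w ((oneParamGenerator V).eigenproj n v) =
      inner ℂ ((oneParamGenerator V).eigenproj n w) ((oneParamGenerator V).eigenproj n v) := by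
  have h1 : (oneParamGenerator V).eigenproj n ((oneParamGenerator V).eigenproj n v) =
      (oneParamGenerator V).eigenproj n v := by
    rw [h.eigenproj_of_mem n (h.eigenproj_mem n v), if_pos rfl]
  conv_lhs => rw [← h1]
  exact (Submodule.inner_starProjection_left_eq_right _ _ _).symm

theorem PositiveCircleGroup.hasSum_norm_sq (h : PositiveCircleGroup V) (v : H) :
    Summable fun n : ℕ => ‖(oneParamGenerator V).eigenproj n v‖ ^ 2 := by
  have h1 := (h.hasSum v).mapL (innerSL ℂ v)
  have h2 := (Complex.hasSum_re h1).summable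
  refine h2.congr fun n => ?_
  rw [innerSL_apply_apply, h.inner_eigenproj, inner_self_eq_norm_sq_to_K]
  norm_cast

/-- The terms are at most `‖E_n w‖² + ‖E_n v‖²`. Absolute convergence is what makes the power series
continuous up to the unit circle. -/
theorem PositiveCircleGroup.summable_norm_inner (h : PositiveCircleGroup V) (v w : H) :
    Summable fun n : ℕ => ‖inner ℂ w ((oneParamGenerator V).eigenproj n v)‖ := by
  refine Summable.of_nonneg_of_le (fun n => norm_nonneg _) (fun n => ?_)
    ((h.hasSum_norm_sq w).add (h.hasSum_norm_sq v))
  rw [h.inner_eigenproj]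
  refine (norm_inner_le_norm _ _).trans ?_
  nlinarith [sq_nonneg (‖(oneParamGenerator V).eigenproj n w‖ -
    ‖(oneParamGenerator V).eigenproj n v‖), norm_nonneg ((oneParamGenerator V).eigenproj n w),
    norm_nonneg ((oneParamGenerator V).eigenproj n v)]

theorem PositiveCircleGroup.hasSum_inner_V (h : PositiveCircleGroup V) (v w : H) (t : ℝ) :
    HasSum (fun n : ℕ => inner ℂ w ((oneParamGenerator V).eigenproj n v) *
      Complex.exp (Complex.I * n * t)) (inner ℂ w (V t v)) := by
  have h1 := (h.hasSum (V t v)).mapL (innerSL ℂ w)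
  simp_rw [h.eigenproj_V, map_smul, innerSL_apply_apply, smul_eq_mul] at h1
  simpa only [mul_comm] using h1

/-- If matrix coefficients of the group cancel for small times, then they cancel spectrally. -/
theorem PositiveCircleGroup.inner_eigenproj_add_eq_zero (h : PositiveCircleGroup V)
    {v w v' w' : H} {ε : ℝ} (hε : 0 < ε)
    (h0 : ∀ t, |t| < ε → inner ℂ w (V t v) + inner ℂ w' (V t v') = 0) (n : ℕ) :
    inner ℂ w ((oneParamGenerator V).eigenproj n v) +
      inner ℂ w' ((oneParamGenerator V).eigenproj n v') = 0 := by
  refine eq_zero_of_tsum_mul_exp_eq_zero (c := fun n : ℕ =>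
    inner ℂ w ((oneParamGenerator V).eigenproj n v) +
      inner ℂ w' ((oneParamGenerator V).eigenproj n v')) ?_ hε (fun t ht => ?_) n
  · exact Summable.of_nonneg_of_le (fun n => norm_nonneg _) (fun n => norm_add_le _ _)
      ((h.summable_norm_inner v w).add (h.summable_norm_inner v' w'))
  · rw [← h0 t ht]
    simp_rw [add_mul]
    exact ((h.hasSum_inner_V v w t).add (h.hasSum_inner_V v' w' t)).tsum_eq

/-- Vanishing for small times kills every spectral coefficient, hence the coefficient at all times.
This is the continuation step behind the Reeh-Schlieder theorem. -/
theorem PositiveCircleGroup.inner_V_eq_zero (h : PositiveCircleGroup V)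
    {v w : H} {ε : ℝ} (hε : 0 < ε) (h0 : ∀ t, |t| < ε → inner ℂ w (V t v) = 0) (t : ℝ) :
    inner ℂ w (V t v) = 0 := by
  have h1 := h.inner_eigenproj_add_eq_zero (w' := 0) (v' := 0) hε (by simpa using h0)
  refine (h.hasSum_inner_V v w t).unique ?_
  simp only [map_zero, inner_zero_left, add_zero] at h1
  simp [h1, hasSum_zero]

/-- Describes the graph by one continuous linear condition per eigenspace; closedness and invariance
under `V t` can be read off. -/
theorem PositiveCircleGroup.mem_graph_pow (h : PositiveCircleGroup V) (k : ℝ) (x : H × H) :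
    x ∈ ((oneParamGenerator V).natSpectrumPow k).graph ↔
      ∀ n : ℕ, (oneParamGenerator V).eigenproj n x.2 =
        (((n : ℝ) ^ k : ℝ) : ℂ) • (oneParamGenerator V).eigenproj n x.1 := by
  rw [← h.pow_iff, LinearPMap.mem_graph_iff]
  constructor
  · rintro ⟨y, h1, h2⟩
    exact ⟨h1 ▸ y.2, by rw [← h2]; congr; exact h1.symm⟩
  · rintro ⟨hv, e⟩
    exact ⟨⟨x.1, hv⟩, rfl, e⟩

theorem PositiveCircleGroup.isClosed_pow (h : PositiveCircleGroup V) (k : ℝ) :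
    ((oneParamGenerator V).natSpectrumPow k).IsClosed := by
  have : (((oneParamGenerator V).natSpectrumPow k).graph : Set (H × H)) =
      ⋂ n : ℕ, {x | (oneParamGenerator V).eigenproj n x.2 =
        (((n : ℝ) ^ k : ℝ) : ℂ) • (oneParamGenerator V).eigenproj n x.1} := by
    ext x
    simp [h.mem_graph_pow]
  rw [LinearPMap.IsClosed, this]
  exact isClosed_iInter fun n => isClosed_eq (by fun_prop) (by fun_prop)

/-- `H × H` carries the sup norm and no inner product, so orthogonal complements are replaced by
Hahn-Banach separation, followed by the Riesz representation in each coordinate. -/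
theorem exists_inner_add_inner_eq_zero {S : Submodule ℂ (H × H)} {x : H × H}
    (hx : x ∉ S.topologicalClosure) : ∃ a b : H,
      (∀ y ∈ S, inner ℂ a y.1 + inner ℂ b y.2 = 0) ∧ inner ℂ a x.1 + inner ℂ b x.2 ≠ 0 := by
  obtain ⟨f, u, hfS, hfx⟩ := RCLike.geometric_hahn_banach_closed_point (𝕜 := ℂ)
    (S.topologicalClosure.restrictScalars ℝ).convex S.isClosed_topologicalClosure hx
  have hu : 0 < u := by simpa using hfS 0 (zero_mem _)
  have hf : ∀ y ∈ S, f y = 0 := by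
    intro y hy
    -- The real part of `f` is bounded by `u` on the subspace, yet on `n · conj (f y) • y` it equals
    -- `n |f y|²`.
    by_contra hne
    have hpos : 0 < Complex.normSq (f y) := Complex.normSq_pos.mpr hne
    obtain ⟨n, hn⟩ := exists_nat_gt (u / Complex.normSq (f y))
    have h1 := hfS (((n : ℂ) * conj (f y)) • y)
      (S.le_topologicalClosure (S.smul_mem _ hy))
    have h2 : ((n : ℂ) * conj (f y)) * f y = ((n * Complex.normSq (f y) : ℝ) : ℂ) := by
      rw [mul_assoc, mul_comm (conj _), Complex.mul_conj]
      push_cast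
      rfl
    rw [map_smul, smul_eq_mul, h2] at h1
    rw [div_lt_iff₀ hpos] at hn
    exact absurd h1 (not_lt.mpr hn.le)
  have key : ∀ y : H × H,
      inner ℂ ((InnerProductSpace.toDual ℂ H).symm (f.comp (.inl ℂ H H))) y.1 +
        inner ℂ ((InnerProductSpace.toDual ℂ H).symm (f.comp (.inr ℂ H H))) y.2 = f y := by
    intro y
    simp [InnerProductSpace.toDual_symm_apply, ← map_add]
  refine ⟨_, _, fun y hy => (key y).trans (hf y hy), fun h => ?_⟩
  rw [(key x).symm.trans h, map_zero] at hfx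
  exact lt_asymm hu hfx

/-- A subspace of the domain of a power of the generator is a core if it contains a small orbit of
every vector of a dense subspace. -/
theorem PositiveCircleGroup.hasCore_pow (h : PositiveCircleGroup V) (k : ℝ)
    {D D₀ : Submodule ℂ H} (hD : D ≤ ((oneParamGenerator V).natSpectrumPow k).domain)
    (hD₀ : Dense (D₀ : Set H)) {ε : ℝ} (hε : 0 < ε)
    (hinv : ∀ v ∈ D₀, ∀ t, |t| < ε → V t v ∈ D) :
    ((oneParamGenerator V).natSpectrumPow k).HasCore D := by
  set L := (oneParamGenerator V).natSpectrumPow k with hL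
  set E : ℕ → H →L[ℂ] H := fun n => (oneParamGenerator V).eigenproj n with hE
  refine LinearPMap.hasCore_of_graph_le (h.isClosed_pow k) hD fun x hx => ?_
  by_contra hcon
  obtain ⟨a, b, hab, hne⟩ := exists_inner_add_inner_eq_zero hcon
  have hmem : ∀ y : H × H, y ∈ L.graph → y.1 ∈ D → y ∈ (L.domRestrict D).graph := by
    intro y hy hy1
    obtain ⟨z, hz1, hz2⟩ := (LinearPMap.mem_graph_iff _).mp hy
    refine (LinearPMap.mem_graph_iff _).mpr ⟨⟨z, hz1 ▸ hy1, z.2⟩, hz1, ?_⟩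
    rw [← hz2]
    exact LinearPMap.domRestrict_apply rfl
  have hV0 : ∀ v, V 0 v = v := fun v => by rw [h.zero]; rfl
  -- For small `t` the pair `(V t v, V t (L v))` lies in the graph over `D`, since `V t` commutes
  -- with every `E n`. The resulting identity in `t` splits into its spectral components.
  have hzero : ∀ v ∈ D₀, ∀ n : ℕ, inner ℂ (E n a + (((n : ℝ) ^ k : ℝ) : ℂ) • E n b) v = 0 := by
    intro v hv n
    have hvD : v ∈ L.domain := hD (hV0 v ▸ hinv v hv 0 (by simpa using hε))
    have hg := (h.mem_graph_pow k (v, L ⟨v, hvD⟩)).mp (LinearPMap.mem_graph _ ⟨v, hvD⟩)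
    have h1 := h.inner_eigenproj_add_eq_zero (v := v) (w := a) (v' := L ⟨v, hvD⟩) (w' := b) hε
      (fun t ht => ?_) n
    · rw [inner_add_left, inner_smul_left, Complex.conj_ofReal, ← h1]
      simp only [] at hg
      rw [hg n, inner_smul_right]
      congr 1
      · exact Submodule.inner_starProjection_left_eq_right _ _ _
      · congr 1
        exact Submodule.inner_starProjection_left_eq_right _ _ _
    · refine hab (V t v, V t (L ⟨v, hvD⟩)) (hmem _ ?_ (hinv v hv t ht))
      refine (h.mem_graph_pow k _).mpr fun m => ?_
      simp only [h.eigenproj_V] at hg ⊢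
      rw [hg m, smul_comm]
  have hEab : ∀ n : ℕ, E n a + (((n : ℝ) ^ k : ℝ) : ℂ) • E n b = 0 := fun n =>
    hD₀.eq_zero_of_inner_left (𝕜 := ℂ) fun v hv => hzero v hv n
  apply hne
  have hg := (h.mem_graph_pow k x).mp hx
  -- Expanded over the eigenspaces, the pairing with `x` has the terms `⟨E_n a + n^k E_n b, x.1⟩ =
  -- 0`.
  have h1 := ((h.hasSum x.1).mapL (innerSL ℂ a)).add ((h.hasSum x.2).mapL (innerSL ℂ b))
  simp only [innerSL_apply_apply] at h1
  refine h1.unique ?_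
  convert hasSum_zero with n
  have h2 := congrArg (fun u => inner ℂ u x.1) (hEab n)
  simp only [inner_add_left, inner_smul_left, Complex.conj_ofReal, inner_zero_left] at h2
  rw [hg n, inner_smul_right, ← h2]
  congr 1
  · exact (Submodule.inner_starProjection_left_eq_right _ _ _).symm
  · congr 1
    exact (Submodule.inner_starProjection_left_eq_right _ _ _).symm

/-- Vectors with smooth orbits are in the domains of all powers of the generator. -/
theorem PositiveCircleGroup.exists_smooth_image (h : PositiveCircleGroup V) {v : H}
    (hv : ContDiff ℝ ∞ fun t => V t v) : ∃ u, (ContDiff ℝ ∞ fun t => V t u) ∧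
      ∀ n : ℕ, (oneParamGenerator V).eigenproj n u =
        (n : ℂ) • (oneParamGenerator V).eigenproj n v := by
  have hd : v ∈ (oneParamGenerator V).domain := (hv.differentiable (by simp)) 0
  refine ⟨oneParamGenerator V ⟨v, hd⟩, ?_, (h.gen_iff _ _).mp ⟨hd, rfl⟩⟩
  have h1 : (fun t => V t (oneParamGenerator V ⟨v, hd⟩)) =
      fun t => (-Complex.I) • deriv (fun t => V t v) t := by
    funext t
    rw [(h.hasDerivAt ⟨v, hd⟩ t).deriv, map_smul, smul_smul]
    simp
  rw [h1]
  exact (contDiff_infty_iff_deriv.mp hv).2.const_smul _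

/-- Iterating `exists_smooth_image` gives `u` with `E_n u = n^m E_n v`, so `‖E_n v‖` decays at least
like `n^{-m}`; taking `m ≥ k + 2` leaves a summable `n^{-2}`. -/
theorem PositiveCircleGroup.mem_domain_pow (h : PositiveCircleGroup V) (k : ℝ) {v : H}
    (hv : ContDiff ℝ ∞ fun t => V t v) : v ∈ ((oneParamGenerator V).natSpectrumPow k).domain := by
  have h1 : ∀ m : ℕ, ∃ u, (ContDiff ℝ ∞ fun t => V t u) ∧
      ∀ n : ℕ, (oneParamGenerator V).eigenproj n u =
        ((n : ℂ) ^ m) • (oneParamGenerator V).eigenproj n v := by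
    intro m
    induction m with
    | zero => exact ⟨v, hv, by simp⟩
    | succ m ih =>
      obtain ⟨u, hu, e⟩ := ih
      obtain ⟨u', hu', e'⟩ := h.exists_smooth_image hu
      refine ⟨u', hu', fun n => ?_⟩
      rw [e', e, smul_smul, pow_succ']
  obtain ⟨m, hm⟩ := exists_nat_ge (k + 2)
  obtain ⟨u, -, e⟩ := h1 m
  change Summable fun n : ℕ => (((n : ℝ) ^ k : ℝ) : ℂ) • (oneParamGenerator V).eigenproj n v
  have hs : Summable fun n : ℕ => ‖u‖ * (1 / (n : ℝ) ^ 2) :=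
    (Real.summable_one_div_nat_pow.mpr one_lt_two).mul_left _
  refine (Summable.of_norm_bounded_eventually_nat hs ?_)
  -- The index `0` is excluded because there the majorant `1 / n ^ 2` is `0`.
  filter_upwards [Filter.eventually_ge_atTop 1] with n hn
  have hn0 : (0 : ℝ) < n := by exact_mod_cast hn
  have hn1 : (1 : ℝ) ≤ n := by exact_mod_cast hn
  have h2 : (n : ℝ) ^ m * ‖(oneParamGenerator V).eigenproj n v‖ ≤ ‖u‖ := by
    have h3 : ‖(oneParamGenerator V).eigenproj n u‖ ≤ ‖u‖ :=
      Submodule.norm_starProjection_apply_le _ _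
    rwa [e, norm_smul, norm_pow, Complex.norm_natCast] at h3
  rw [norm_smul, Complex.norm_real, Real.norm_of_nonneg (by positivity), mul_one_div,
    le_div_iff₀ (by positivity)]
  refine le_trans ?_ h2
  rw [mul_right_comm]
  gcongr
  rw [← Real.rpow_natCast, ← Real.rpow_natCast, ← Real.rpow_add hn0]
  exact Real.rpow_le_rpow_of_exponent_le hn1 (by exact_mod_cast hm)

end Core

/-! ### Geometry of intervals -/

namespace Mob

@[simp]
theorem coe_rotation_apply (α : ℝ) (z : Circle) : (rotation α).1 z = Circle.exp α * z := rfl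

@[simp]
theorem coe_mul_apply (φ ψ : Mob) (z : Circle) : (φ * ψ).1 z = φ.1 (ψ.1 z) := rfl

theorem coe_apply_inv_coe (φ : Mob) (z : Circle) : φ.1 ((φ⁻¹).1 z) = z := φ.1.apply_symm_apply z

theorem coe_ofCoeff_inv_apply (p : MobCoeff) (z : Circle) :
    ((ofCoeff p)⁻¹).1 z = p.inv.toFun z := rfl

theorem rotation_add (α β : ℝ) : rotation (α + β) = rotation α * rotation β :=
  Subtype.ext (Homeomorph.ext fun z => by
    change Circle.exp (α + β) * z = Circle.exp α * (Circle.exp β * z)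
    rw [Circle.exp_add, mul_assoc])

theorem rotation_zero : rotation 0 = 1 :=
  Subtype.ext (Homeomorph.ext fun z => by
    change Circle.exp 0 * z = z
    simp)

theorem rotation_neg (α : ℝ) : rotation (-α) = (rotation α)⁻¹ := by
  rw [eq_inv_iff_mul_eq_one, ← rotation_add, neg_add_cancel, rotation_zero]

end Mob

theorem Circle.dist_eq_norm_coe_sub (z w : Circle) : dist z w = ‖(z : ℂ) - w‖ :=
  dist_eq_norm (z : ℂ) w

theorem CircleInterval.coe_map (φ : Mob) (I : CircleInterval) :
    (I.map φ).carrier = φ.1 '' I.carrier := rfl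

/-- Conjugated rotations by small angles move an interval inside any neighbourhood of its
closure. -/
theorem CircleInterval.exists_conj_rotation_subset {J I : CircleInterval}
    (h : closure J.carrier ⊆ I.carrier) (g : Mob) : ∃ ε > 0, ∀ α : ℝ, |α| < ε →
      (J.map (g * Mob.rotation α * g⁻¹)).carrier ⊆ I.carrier := by
  have hc : Continuous fun x : ℝ × Circle => g.1 (Circle.exp x.1 * (g⁻¹).1 x.2) :=
    g.1.continuous.comp
      ((Circle.exp.continuous.comp continuous_fst).mul ((g⁻¹).1.continuous.comp continuous_snd))
  have h1 : ∀ᶠ α : ℝ in nhds 0, ∀ z ∈ closure J.carrier,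
      g.1 (Circle.exp α * (g⁻¹).1 z) ∈ I.carrier := by
    -- The closure of `J` is compact, so one bound on `α` serves all of its points.
    refine isClosed_closure.isCompact.eventually_forall_of_forall_eventually fun z hz => ?_
    refine (hc.tendsto (0, z)).eventually (I.isOpen.mem_nhds ?_)
    simp only [Circle.exp_zero, one_mul, Mob.coe_apply_inv_coe]
    exact h hz
  obtain ⟨ε, hε, hα⟩ := Metric.eventually_nhds_iff.mp h1
  refine ⟨ε, hε, fun α h2 => ?_⟩
  rintro _ ⟨z, hz, rfl⟩
  exact hα (by simpa using h2) z (subset_closure hz)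

/-- The boost with attracting fixed point `p` and repelling fixed point `-p`. -/
noncomputable def MobCoeff.boost (p : Circle) (n : ℕ) : MobCoeff where
  a := (√(1 + (n : ℝ) ^ 2) : ℝ)
  b := (p : ℂ) * n
  normSq_sub := by
    rw [Complex.normSq_ofReal, Real.mul_self_sqrt (by positivity), Complex.normSq_mul,
      Circle.normSq_coe, Complex.normSq_natCast]
    ring

/-- With `c = √(1 + n²)` the difference is `(c - n)(z - p) / (n p̄ z + c)`. The numerator is at most
`2` as `0 ≤ c - n ≤ 1`. After multiplication by `p` the denominator is `n (z + p) + (c - n) p`, of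
modulus at least `n δ - 1`. -/
theorem MobCoeff.dist_boost_le (p : Circle) (n : ℕ) {δ : ℝ} (hδ : 1 < n * δ) (z : Circle)
    (hz : δ ≤ ‖(z : ℂ) + p‖) : ‖((boost p n).toFun z : ℂ) - p‖ ≤ 2 / (n * δ - 1) := by
  have hd := (boost p n).denom_ne_zero z
  have hp : conj (p : ℂ) * p = 1 := by
    rw [mul_comm, Complex.mul_conj, Circle.normSq_coe, Complex.ofReal_one]
  set c : ℝ := √(1 + (n : ℝ) ^ 2) with hc
  have hn0 : (0 : ℝ) ≤ n := n.cast_nonneg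
  have hc0 : (n : ℝ) ≤ c := Real.le_sqrt_of_sq_le (by linarith)
  have hc1 : c ≤ n + 1 := Real.sqrt_le_iff.mpr ⟨by positivity, by nlinarith⟩
  have e1 : ((boost p n).toFun z : ℂ) - p =
      (c - n : ℝ) * (z - p) / (conj (p : ℂ) * n * z + c) := by
    rw [coe_toFun, eq_div_iff (by simpa [boost] using hd), sub_mul, div_mul_eq_mul_div]
    rw [show conj (boost p n).b * (z : ℂ) + conj (boost p n).a = conj (p : ℂ) * n * z + c by
      simp [boost, hc]] at hd ⊢
    rw [mul_div_cancel_right₀ _ hd]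
    simp only [boost]
    push_cast
    linear_combination (-(n : ℂ) * z) * hp
  have e2 : ‖conj (p : ℂ) * n * z + c‖ = ‖(n : ℂ) * (z + p) + (c - n : ℝ) * p‖ := by
    rw [← one_mul ‖conj (p : ℂ) * n * z + c‖, ← Circle.norm_coe p, ← norm_mul]
    congr 1
    push_cast
    linear_combination ((n : ℂ) * z) * hp
  have e3 : n * δ - 1 ≤ ‖conj (p : ℂ) * n * z + c‖ := by
    rw [e2]
    have h1 := norm_sub_le_norm_add ((n : ℂ) * (z + p)) ((c - n : ℝ) * p)
    rw [norm_mul, norm_mul, Circle.norm_coe, Complex.norm_natCast, Complex.norm_real,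
      Real.norm_of_nonneg (by linarith)] at h1
    nlinarith
  rw [e1, norm_div]
  refine div_le_div₀ zero_le_two ?_ (by linarith) e3
  rw [norm_mul, Complex.norm_real, Real.norm_of_nonneg (by linarith)]
  have h2 := norm_sub_le (z : ℂ) p
  rw [Circle.norm_coe, Circle.norm_coe] at h2
  nlinarith [norm_nonneg ((z : ℂ) - p)]

/-- A conjugate of the rotation by `π` moves a given interval into a given neighbourhood of a point
which does not belong to its closure. -/
theorem CircleInterval.exists_conj_rotation_pi_subset (J : CircleInterval) {p : Circle}
    (hp : p ∉ closure J.carrier) {s : Set Circle} (hs : s ∈ nhds p) :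
    ∃ g : Mob, (J.map (g * Mob.rotation Real.pi * g⁻¹)).carrier ⊆ s := by
  obtain ⟨δ', hδ', hJ⟩ : ∃ δ > 0, ∀ z ∈ J.carrier, δ ≤ ‖(z : ℂ) - p‖ := by
    obtain ⟨δ, h0, hδ⟩ := Metric.isOpen_iff.mp isClosed_closure.isOpen_compl p hp
    refine ⟨δ, h0, fun z hz => ?_⟩
    by_contra! hlt
    exact hδ (show dist z p < δ by rwa [Circle.dist_eq_norm_coe_sub]) (subset_closure hz)
  obtain ⟨η, hη, hs⟩ := Metric.mem_nhds_iff.mp hs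
  -- Both caps at `1` serve a second application of the boost: a point within `1` of `p` is at
  -- distance at least `1` from `-p`.
  set δ := min δ' 1 with hδdef
  have hδ : 0 < δ := lt_min hδ' one_pos
  obtain ⟨n, hn⟩ := exists_nat_gt ((2 / min η 1 + 1) / δ)
  rw [div_lt_iff₀ hδ] at hn
  have hη' : 0 < min η 1 := lt_min hη one_pos
  have hn1 : 1 < n * δ := lt_trans (by linarith [div_pos two_pos hη']) hn
  have hsmall : 2 / (n * δ - 1) < min η 1 := by
    rw [div_lt_iff₀ (by linarith), ← div_lt_iff₀' hη']
    linarith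
  have key : ∀ z : Circle, δ ≤ ‖(z : ℂ) + p‖ →
      ‖((MobCoeff.boost p n).toFun z : ℂ) - p‖ < min η 1 := fun z hz =>
    (MobCoeff.dist_boost_le p n hn1 z hz).trans_lt hsmall
  refine ⟨Mob.ofCoeff (MobCoeff.boost p n), ?_⟩
  rintro _ ⟨z, hz, rfl⟩
  set y : Circle := Circle.exp Real.pi * z with hy
  have hyc : (y : ℂ) = -z := by simp [hy]
  -- The half-turn exchanges the fixed points of the boost `B`, hence inverts it under conjugation:
  -- `B ρ_π B⁻¹ = B² ρ_π`. As `z` stays away from `p`, the point `y = -z` stays away from the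
  -- repelling point `-p`.
  have h1 : (((Mob.ofCoeff (MobCoeff.boost p n) * Mob.rotation Real.pi *
      (Mob.ofCoeff (MobCoeff.boost p n))⁻¹).1 z : Circle) : ℂ) =
      (MobCoeff.boost p n).toFun ((MobCoeff.boost p n).toFun y) := by
    rw [Mob.coe_mul_apply, Mob.coe_mul_apply, Mob.coe_ofCoeff_inv_apply, Mob.coe_rotation_apply]
    change ((MobCoeff.boost p n).toFun _ : ℂ) = _
    congr 2
    refine Circle.ext ?_
    rw [Circle.coe_mul, MobCoeff.coe_toFun, MobCoeff.coe_toFun, hyc]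
    simp [MobCoeff.inv, MobCoeff.boost]
    rw [← neg_div]
    congr 1
    ring
  refine hs ?_
  rw [Metric.mem_ball, Circle.dist_eq_norm_coe_sub, h1]
  refine (key _ ?_).trans_le (min_le_left _ _)
  have h2 : ‖((MobCoeff.boost p n).toFun y : ℂ) - p‖ < 1 := by
    refine (key _ ?_).trans_le (min_le_right _ _)
    rw [hyc, neg_add_eq_sub, norm_sub_rev]
    exact (min_le_left _ _).trans (hJ z hz)
  refine (min_le_right _ _).trans ?_
  have h3 := norm_sub_norm_le (2 * (p : ℂ)) (p - (MobCoeff.boost p n).toFun y)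
  rw [norm_mul, Circle.norm_coe, norm_sub_rev (p : ℂ)] at h3
  rw [show ((MobCoeff.boost p n).toFun y : ℂ) + p =
    2 * (p : ℂ) - (p - (MobCoeff.boost p n).toFun y) by ring]
  norm_num at h3 ⊢
  linarith

theorem CircleInterval.exists_notMem_closure (I : CircleInterval) :
    ∃ p, p ∉ closure I.carrier := by
  by_contra! h
  exact I.not_dense h

theorem Mob.exists_rotation_apply_eq (p q : Circle) : ∃ α, (Mob.rotation α).1 p = q :=
  ⟨Complex.arg ((q * p⁻¹ : Circle) : ℂ), by
    rw [coe_rotation_apply, Circle.exp_arg, inv_mul_cancel_right]⟩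

theorem exists_mem_nhds_closure_subset {X : Type*} [TopologicalSpace X] [RegularSpace X] {s : Set X}
    {p : X} (hs : s ∈ nhds p) : ∃ t ∈ nhds p, closure t ⊆ s := by
  obtain ⟨t, ht, hc, hts⟩ := exists_mem_nhds_isClosed_subset hs
  exact ⟨t, ht, hc.closure_eq.symm ▸ hts⟩

/-- No endpoints are available. Instead, `I` is rotated so that its closure misses a chosen `q ∈ I`,
and then a Möbius map sends it into a small neighbourhood of `q`. -/
theorem CircleInterval.exists_closure_subset (I : CircleInterval) :
    ∃ J : CircleInterval, closure J.carrier ⊆ I.carrier := by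
  obtain ⟨p, hp⟩ := I.exists_notMem_closure
  obtain ⟨q, hq⟩ := I.isConnected.nonempty
  obtain ⟨α, hα⟩ := Mob.exists_rotation_apply_eq p q
  obtain ⟨t, ht, hts⟩ := exists_mem_nhds_closure_subset (I.isOpen.mem_nhds hq)
  have hq' : q ∉ closure (I.map (Mob.rotation α)).carrier := by
    rw [coe_map, ← (Mob.rotation α).1.image_closure, ← hα]
    rintro ⟨z, hz, e⟩
    exact hp ((Mob.rotation α).1.injective e ▸ hz)
  obtain ⟨g, hg⟩ := (I.map (Mob.rotation α)).exists_conj_rotation_pi_subset hq' ht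
  exact ⟨_, (closure_mono hg).trans hts⟩

/-! ### The Reeh-Schlieder property -/

namespace MobiusCovariantNet

variable {H : Type*} [NormedAddCommGroup H] [InnerProductSpace ℂ H] [CompleteSpace H]
  (N : MobiusCovariantNet H)

theorem U_mul_apply (φ ψ : Mob) (v : H) : (N.U (φ * ψ) : H →L[ℂ] H) v =
    (N.U φ : H →L[ℂ] H) ((N.U ψ : H →L[ℂ] H) v) := by
  rw [map_mul]; rfl

theorem U_inv_apply_U (φ : Mob) (v : H) :
    (N.U φ⁻¹ : H →L[ℂ] H) ((N.U φ : H →L[ℂ] H) v) = v := by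
  rw [← U_mul_apply, inv_mul_cancel, map_one]; rfl

theorem inner_U (φ : Mob) (v w : H) : inner ℂ w ((N.U φ : H →L[ℂ] H) v) =
    inner ℂ ((N.U φ⁻¹ : H →L[ℂ] H) w) v := by
  conv_rhs => rw [← N.U_inv_apply_U φ v]
  exact (ContinuousLinearMap.inner_map_map_of_mem_unitary (N.U φ⁻¹).2 _ _).symm

/-- The subspace `𝒜(I)Ω`. -/
def localVacuumSpace (I : CircleInterval) : Submodule ℂ H where
  carrier := {v | ∃ T ∈ N.alg I, v = T N.Ω}
  add_mem' := by
    rintro _ _ ⟨S, hS, rfl⟩ ⟨T, hT, rfl⟩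
    exact ⟨S + T, add_mem hS hT, rfl⟩
  zero_mem' := ⟨0, zero_mem _, rfl⟩
  smul_mem' := by
    rintro c _ ⟨T, hT, rfl⟩
    exact ⟨c • T, (N.alg I).toStarSubalgebra.smul_mem hT c, rfl⟩

variable {N}

theorem localVacuumSpace_mono {I J : CircleInterval} (h : I.carrier ⊆ J.carrier) :
    N.localVacuumSpace I ≤ N.localVacuumSpace J := by
  rintro _ ⟨T, hT, rfl⟩
  exact ⟨T, N.isotony I J h hT, rfl⟩

theorem U_mem_localVacuumSpace {I : CircleInterval} (φ : Mob) {v : H}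
    (hv : v ∈ N.localVacuumSpace I) :
    (N.U φ : H →L[ℂ] H) v ∈ N.localVacuumSpace (I.map φ) := by
  obtain ⟨T, hT, rfl⟩ := hv
  refine ⟨(N.U φ : H →L[ℂ] H) * T * ((N.U φ)⁻¹ : unitary (H →L[ℂ] H)),
    (N.covariance φ I).subset ⟨T, hT, rfl⟩, ?_⟩
  have := N.vacuum_invariant φ⁻¹
  rw [map_inv] at this
  change _ = (N.U φ : H →L[ℂ] H) (T ((((N.U φ)⁻¹ : unitary (H →L[ℂ] H)) : H →L[ℂ] H) N.Ω))
  rw [this]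

theorem localVacuumSpace_map_le {I : CircleInterval} (φ : Mob) :
    N.localVacuumSpace (I.map φ) ≤
      (N.localVacuumSpace I).map (N.U φ : H →L[ℂ] H).toLinearMap := by
  rintro _ ⟨S, hS, rfl⟩
  obtain ⟨T, hT, rfl⟩ := (N.covariance φ I).superset hS
  refine ⟨T N.Ω, ⟨T, hT, rfl⟩, ?_⟩
  have := N.vacuum_invariant φ⁻¹
  rw [map_inv] at this
  change (N.U φ : H →L[ℂ] H) (T N.Ω) =
    (N.U φ : H →L[ℂ] H) (T ((((N.U φ)⁻¹ : unitary (H →L[ℂ] H)) : H →L[ℂ] H) N.Ω))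
  rw [this]

/-- Positivity of the energy propagates orthogonality along conjugated rotations. -/
theorem orthogonal_localVacuumSpace_conj_rotation {I J : CircleInterval}
    (h : closure J.carrier ⊆ I.carrier) (g : Mob) (α : ℝ) :
    (N.localVacuumSpace I)ᗮ ≤
      (N.localVacuumSpace (J.map (g * Mob.rotation α * g⁻¹)))ᗮ := by
  intro w hw
  obtain ⟨ε, hε, hsub⟩ := CircleInterval.exists_conj_rotation_subset h g
  rw [Submodule.mem_orthogonal'] at hw ⊢
  intro u hu
  obtain ⟨v, hv, rfl⟩ := localVacuumSpace_map_le _ hu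
  change inner ℂ w ((N.U (g * Mob.rotation α * g⁻¹) : H →L[ℂ] H) v) = 0
  -- Moving `g` onto both vectors leaves a matrix coefficient of the positive-energy group of
  -- rotations.
  have key : ∀ t, inner ℂ w ((N.U (g * Mob.rotation t * g⁻¹) : H →L[ℂ] H) v) =
      inner ℂ ((N.U g⁻¹ : H →L[ℂ] H) w)
        ((N.U (Mob.rotation t) : H →L[ℂ] H) ((N.U g⁻¹ : H →L[ℂ] H) v)) := by
    intro t
    rw [U_mul_apply, U_mul_apply, inner_U]
  rw [key]
  refine N.positiveCircleGroup.inner_V_eq_zero hε (fun t ht => ?_) α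
  rw [← key]
  exact hw _ (localVacuumSpace_mono (hsub t ht) (U_mem_localVacuumSpace _ hv))

/-- Orthogonality is propagated twice. A rotation takes a smaller interval `I₁` to `I₂`, which
contains a point `p` off the closure of `J`. A conjugated half-turn moves `J` well inside `I₂`, and
propagating along its inverse returns to `J`. -/
theorem orthogonal_localVacuumSpace_le (I J : CircleInterval) :
    (N.localVacuumSpace I)ᗮ ≤ (N.localVacuumSpace J)ᗮ := by
  obtain ⟨I₁, hI₁⟩ := I.exists_closure_subset
  obtain ⟨p, hp⟩ := J.exists_notMem_closure
  obtain ⟨q, hq⟩ := I₁.isConnected.nonempty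
  obtain ⟨α, hα⟩ := Mob.exists_rotation_apply_eq q p
  set I₂ := I₁.map (1 * Mob.rotation α * 1⁻¹) with hI₂
  have hpI₂ : p ∈ I₂.carrier := by
    rw [hI₂, inv_one, one_mul, mul_one]
    exact ⟨q, hq, hα⟩
  obtain ⟨t, ht, hts⟩ := exists_mem_nhds_closure_subset (I₂.isOpen.mem_nhds hpI₂)
  obtain ⟨g, hg⟩ := J.exists_conj_rotation_pi_subset hp ht
  refine (orthogonal_localVacuumSpace_conj_rotation hI₁ 1 α).trans ?_
  refine (orthogonal_localVacuumSpace_conj_rotation ((closure_mono hg).trans hts) g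
    (-Real.pi)).trans (Submodule.orthogonal_le (localVacuumSpace_mono ?_))
  intro z hz
  refine ⟨_, ⟨z, hz, rfl⟩, ?_⟩
  rw [← Mob.coe_mul_apply, Mob.rotation_neg]
  simp only [mul_assoc, inv_mul_cancel_left, mul_inv_cancel]
  rfl

/-- The **Reeh-Schlieder theorem**: the vacuum is cyclic for every local algebra. -/
theorem dense_localVacuumSpace (I : CircleInterval) : Dense (N.localVacuumSpace I : Set H) := by
  rw [Submodule.dense_iff_topologicalClosure_eq_top, Submodule.topologicalClosure_eq_top_iff]
  set M := (N.localVacuumSpace I)ᗮ with hM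
  -- `M` is the same subspace for every interval, so it may be tested against `𝒜(J)Ω`, which `star
  -- T` preserves.
  have hinv : ∀ J, ∀ T ∈ N.alg J, ∀ w ∈ M, T w ∈ M := by
    intro J T hT w hw
    refine orthogonal_localVacuumSpace_le J I ((Submodule.mem_orthogonal' _ _).mpr ?_)
    rintro _ ⟨S, hS, rfl⟩
    rw [← ContinuousLinearMap.adjoint_inner_right]
    exact (Submodule.mem_orthogonal' _ _).mp (orthogonal_localVacuumSpace_le I J hw) _
      ⟨star T * S, mul_mem (star_mem hT) hS, rfl⟩
  -- `M` is invariant under both `T` and `star T`, hence reduces `T`. The projection thus commutes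
  -- with all local algebras and kills `Ω`, so cyclicity makes it zero.
  have hcomm : ∀ J, ∀ T ∈ N.alg J, T * M.starProjection = M.starProjection * T := by
    intro J T hT
    ext v
    change T (M.starProjection v) = M.starProjection (T v)
    symm
    refine Submodule.eq_starProjection_of_mem_of_inner_eq_zero
      (hinv J T hT _ (Submodule.starProjection_apply_mem _ _)) fun w hw => ?_
    rw [← map_sub, ← ContinuousLinearMap.adjoint_inner_right]
    exact Submodule.starProjection_inner_eq_zero v _ (hinv J _ (star_mem hT) w hw)
  have hΩ : M.starProjection N.Ω = 0 := by
    rw [Submodule.starProjection_apply_eq_zero_iff]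
    exact Submodule.le_orthogonal_orthogonal _ ⟨1, one_mem _, rfl⟩
  have hP : ∀ v, M.starProjection v = 0 := by
    intro v
    refine N.vacuum_cyclic.induction (P := fun v => M.starProjection v = 0) ?_ ?_ v
    · rintro _ ⟨T, hT, rfl⟩
      have h1 : M.starProjection * T = T * M.starProjection := by
        refine hT _ (Set.mem_centralizer_iff.mpr fun S hS => ?_)
        obtain ⟨J, hJ⟩ := Set.mem_iUnion.mp hS
        exact hcomm J S hJ
      have h2 := congrArg (fun A : H →L[ℂ] H => A N.Ω) h1
      change M.starProjection (T N.Ω) = T (M.starProjection N.Ω) at h2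
      rw [h2, hΩ, map_zero]
    · exact isClosed_eq (by fun_prop) continuous_const
  rw [Submodule.eq_bot_iff]
  intro w hw
  rw [← Submodule.starProjection_eq_self_iff.mpr hw, hP]

end MobiusCovariantNet

/-! ### Smoothing of local operators -/

/-- Strong continuity becomes joint continuity because every `V t` is isometric. -/
theorem PositiveCircleGroup.continuous_comp {H : Type*} [NormedAddCommGroup H]
    [InnerProductSpace ℂ H] [CompleteSpace H] {V : ℝ → H →L[ℂ] H} (h : PositiveCircleGroup V)
    {x : ℝ → H} (hx : Continuous x) : Continuous fun t => V t (x t) := by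
  have hn : ∀ t v, ‖V t v‖ = ‖v‖ := fun t v => by
    rw [@norm_eq_sqrt_re_inner ℂ, h.isom, ← @norm_eq_sqrt_re_inner ℂ]
  rw [continuous_iff_continuousAt]
  intro s
  rw [ContinuousAt, tendsto_iff_norm_sub_tendsto_zero]
  have h1 := ((hx.sub continuous_const).norm.add
    (((h.cont (x s)).sub continuous_const).norm)).tendsto' (f := fun t =>
      ‖x t - x s‖ + ‖V t (x s) - V s (x s)‖) s 0 (by simp)
  refine squeeze_zero (fun t => norm_nonneg _) (fun t => ?_) h1
  calc ‖V t (x t) - V s (x s)‖ = ‖V t (x t - x s) + (V t (x s) - V s (x s))‖ := by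
        rw [map_sub, sub_add_sub_cancel]
    _ ≤ _ := by
        refine (norm_add_le _ _).trans ?_
        rw [hn]

namespace MobiusCovariantNet

variable {H : Type*} [NormedAddCommGroup H] [InnerProductSpace ℂ H] [CompleteSpace H]
  (N : MobiusCovariantNet H)

theorem star_U (φ : Mob) : star (N.U φ : H →L[ℂ] H) = N.U φ⁻¹ := by
  rw [map_inv]; rfl

theorem rotated_apply (T : H →L[ℂ] H) (α : ℝ) (v : H) : N.rotated T α v =
    (N.U (Mob.rotation α) : H →L[ℂ] H) (T ((N.U (Mob.rotation (-α)) : H →L[ℂ] H) v)) := by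
  rw [rotated, star_U, Mob.rotation_neg]
  rfl

theorem U_rotation_add (α β : ℝ) (v : H) : (N.U (Mob.rotation (α + β)) : H →L[ℂ] H) v =
    (N.U (Mob.rotation α) : H →L[ℂ] H) ((N.U (Mob.rotation β) : H →L[ℂ] H) v) := by
  rw [Mob.rotation_add, U_mul_apply]

theorem rotated_zero (T : H →L[ℂ] H) : N.rotated T 0 = T := by
  rw [rotated, Mob.rotation_zero, map_one]
  simp

theorem rotated_rotated (T : H →L[ℂ] H) (α β : ℝ) :
    N.rotated (N.rotated T α) β = N.rotated T (α + β) := by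
  ext v
  rw [rotated_apply, rotated_apply, rotated_apply, ← U_rotation_add, ← U_rotation_add,
    add_comm β, neg_add]

theorem rotated_apply_Ω (T : H →L[ℂ] H) (α : ℝ) :
    N.rotated T α N.Ω = (N.U (Mob.rotation α) : H →L[ℂ] H) (T N.Ω) := by
  rw [rotated_apply, N.vacuum_invariant]

theorem norm_U_apply (φ : Mob) (v : H) : ‖(N.U φ : H →L[ℂ] H) v‖ = ‖v‖ :=
  ContinuousLinearMap.norm_map_of_mem_unitary (N.U φ).2 v

theorem norm_rotated_apply_le (T : H →L[ℂ] H) (α : ℝ) (v : H) :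
    ‖N.rotated T α v‖ ≤ ‖T‖ * ‖v‖ := by
  rw [rotated_apply, norm_U_apply]
  refine (T.le_opNorm _).trans ?_
  rw [norm_U_apply]

theorem continuous_rotated_apply (T : H →L[ℂ] H) (v : H) :
    Continuous fun α => N.rotated T α v := by
  simp_rw [rotated_apply]
  exact N.positiveCircleGroup.continuous_comp
    (T.continuous.comp ((N.positiveCircleGroup.cont v).comp continuous_neg))

variable {N}

theorem rotated_mem {I J : CircleInterval} {T : H →L[ℂ] H} (hT : T ∈ N.alg J) {α : ℝ}
    (h : (J.map (Mob.rotation α)).carrier ⊆ I.carrier) : N.rotated T α ∈ N.alg I :=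
  N.isotony _ _ h ((N.covariance (Mob.rotation α) J).subset ⟨T, hT, rfl⟩)

theorem exists_rotated_mem {I J : CircleInterval} (h : closure J.carrier ⊆ I.carrier) :
    ∃ ε > 0, ∀ T ∈ N.alg J, ∀ α : ℝ, |α| < ε → N.rotated T α ∈ N.alg I := by
  obtain ⟨ε, hε, hsub⟩ := CircleInterval.exists_conj_rotation_subset h 1
  refine ⟨ε, hε, fun T hT α hα => rotated_mem hT ?_⟩
  simpa using hsub α hα

/-- The double commutant theorem gives a vectorwise test for membership, suited to strongly
convergent integrals. -/
theorem mem_alg_of_commute {I : CircleInterval} {T : H →L[ℂ] H}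
    (h : ∀ S ∈ (N.alg I).commutant, ∀ v, S (T v) = T (S v)) : T ∈ N.alg I := by
  rw [← VonNeumannAlgebra.commutant_commutant (N.alg I), VonNeumannAlgebra.mem_commutant_iff]
  exact fun S hS => ContinuousLinearMap.ext (h S hS)

theorem commutant_commute {I : CircleInterval} {S T : H →L[ℂ] H}
    (hS : S ∈ (N.alg I).commutant) (hT : T ∈ N.alg I) (v : H) : S (T v) = T (S v) :=
  (congrArg (fun A : H →L[ℂ] H => A v) (VonNeumannAlgebra.mem_commutant_iff.mp hS T hT)).symm

variable (N) in
/-- The strong integral `∫ U(ρ_s) T U(ρ_s)* ds` from `a` to `b`. -/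
noncomputable def rotationIntegral (T : H →L[ℂ] H) (a b : ℝ) : H →L[ℂ] H :=
  LinearMap.mkContinuous
    { toFun := fun v => ∫ s in a..b, N.rotated T s v
      map_add' := fun v w => by
        simp_rw [map_add]
        exact intervalIntegral.integral_add
          ((N.continuous_rotated_apply T v).intervalIntegrable _ _)
          ((N.continuous_rotated_apply T w).intervalIntegrable _ _)
      map_smul' := fun c v => by
        simp_rw [map_smul]
        exact intervalIntegral.integral_smul c _ }
    (‖T‖ * |b - a|) fun v => by
      refine (intervalIntegral.norm_integral_le_of_norm_le_const
        fun s _ => N.norm_rotated_apply_le T s v).trans_eq ?_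
      ring

theorem rotationIntegral_apply (T : H →L[ℂ] H) (a b : ℝ) (v : H) :
    N.rotationIntegral T a b v = ∫ s in a..b, N.rotated T s v := rfl

theorem norm_rotationIntegral_le (T : H →L[ℂ] H) (a b : ℝ) :
    ‖N.rotationIntegral T a b‖ ≤ ‖T‖ * |b - a| :=
  LinearMap.mkContinuous_norm_le _ (by positivity) _

theorem rotationIntegral_add (T : H →L[ℂ] H) (a b c : ℝ) :
    N.rotationIntegral T a b + N.rotationIntegral T b c = N.rotationIntegral T a c := by
  ext v
  exact intervalIntegral.integral_add_adjacent_intervals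
    ((N.continuous_rotated_apply T v).intervalIntegrable _ _)
    ((N.continuous_rotated_apply T v).intervalIntegrable _ _)

theorem rotated_rotationIntegral (T : H →L[ℂ] H) (a b β : ℝ) :
    N.rotated (N.rotationIntegral T a b) β = N.rotationIntegral T (a + β) (b + β) := by
  ext v
  rw [rotated_apply, rotationIntegral_apply, rotationIntegral_apply,
    ← ContinuousLinearMap.intervalIntegral_comp_comm _
      ((N.continuous_rotated_apply T _).intervalIntegrable _ _),
    ← intervalIntegral.integral_comp_add_right (fun s => N.rotated T s v)]
  simp_rw [← rotated_apply, rotated_rotated]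

/-- The orbit of `T` itself is only strongly continuous. Rotating the integral merely shifts its
limits, on which it depends in a norm-Lipschitz way. -/
theorem continuous_rotated_rotationIntegral (T : H →L[ℂ] H) (a b : ℝ) :
    Continuous (N.rotated (N.rotationIntegral T a b)) := by
  have : N.rotated (N.rotationIntegral T a b) = fun β =>
      (N.rotationIntegral T a b + N.rotationIntegral T 0 (b + β)) -
        (N.rotationIntegral T 0 b + (N.rotationIntegral T 0 (a + β) - N.rotationIntegral T 0 a)) := by
    funext β
    rw [rotated_rotationIntegral, ← rotationIntegral_add T 0 (a + β) (b + β),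
      ← rotationIntegral_add T 0 a b]
    abel
  rw [this]
  have hc : Continuous (N.rotationIntegral T 0) := by
    refine (LipschitzWith.of_dist_le_mul (K := ‖T‖₊) fun s t => ?_).continuous
    rw [dist_eq_norm, Real.dist_eq, ← rotationIntegral_add T 0 t s, add_sub_cancel_left]
    exact norm_rotationIntegral_le T t s
  fun_prop

theorem rotationIntegral_mem {I : CircleInterval} {T : H →L[ℂ] H} {a b : ℝ}
    (h : ∀ s ∈ Set.uIcc a b, N.rotated T s ∈ N.alg I) : N.rotationIntegral T a b ∈ N.alg I := by
  refine mem_alg_of_commute fun S hS v => ?_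
  rw [rotationIntegral_apply, rotationIntegral_apply,
    ← ContinuousLinearMap.intervalIntegral_comp_comm _
      ((N.continuous_rotated_apply T _).intervalIntegrable _ _)]
  exact intervalIntegral.integral_congr fun s hs => commutant_commute hS (h s hs) v

theorem hasDerivAt_rotationIntegral (T : H →L[ℂ] H) (v : H) :
    HasDerivAt (fun s => N.rotationIntegral T 0 s v) (T v) 0 := by
  have hc := N.continuous_rotated_apply T v
  have h1 := intervalIntegral.integral_hasDerivAt_right (hc.intervalIntegrable 0 0)
    (hc.stronglyMeasurableAtFilter _ _) hc.continuousAt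
  rwa [rotated_zero] at h1

open MeasureTheory in
/-- Operators with norm continuous orbits are approximated by smooth ones. -/
theorem exists_smoothAlg_dist_le {I J : CircleInterval} (h : closure J.carrier ⊆ I.carrier)
    {T : H →L[ℂ] H} (hT : T ∈ N.alg J) (hc : Continuous (N.rotated T)) {η : ℝ} (hη : 0 < η) :
    ∃ S ∈ N.smoothAlg I, dist S T ≤ η := by
  obtain ⟨ε, hε, hmem⟩ := exists_rotated_mem (N := N) h
  obtain ⟨δ, hδ, hdist⟩ := Metric.continuous_iff.mp hc 0 η hη
  have hm : 0 < min ε δ := lt_min hε hδ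
  -- Support within `ε` keeps the average in `𝒜(I)`; support within `δ` keeps it `η`-close to `T`.
  let φ : ContDiffBump (0 : ℝ) := ⟨min ε δ / 2, min ε δ, by positivity, by linarith⟩
  have hφc : HasCompactSupport (φ.normed volume) := φ.hasCompactSupport_normed
  have hφ : Continuous (φ.normed volume) := φ.continuous_normed
  set G : ℝ → H →L[ℂ] H :=
    convolution (φ.normed volume) (N.rotated T) (ContinuousLinearMap.lsmul ℝ ℝ) volume with hG
  have hGapp : ∀ β, G β = ∫ t, φ.normed volume t • N.rotated T (β - t) := fun β => rfl
  have hint : ∀ β, Integrable (fun t => φ.normed volume t • N.rotated T (β - t)) := fun β =>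
    Continuous.integrable_of_hasCompactSupport (by fun_prop) (hφc.smul_right)
  -- The convolution is itself the orbit of `G 0`, so its smoothness in `β` is the smoothness
  -- required of `G 0`.
  have hrot : N.rotated (G 0) = G := by
    funext β
    have h1 := ((ContinuousLinearMap.mul ℝ (H →L[ℂ] H) (N.U (Mob.rotation β) : H →L[ℂ] H)).comp
      ((ContinuousLinearMap.mul ℝ (H →L[ℂ] H)).flip
        (star (N.U (Mob.rotation β) : H →L[ℂ] H)))).integral_comp_comm (hint 0)
    rw [← hGapp] at h1
    simp only [ContinuousLinearMap.comp_apply, ContinuousLinearMap.flip_apply,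
      ContinuousLinearMap.mul_apply'] at h1
    rw [rotated, mul_assoc, ← h1, hGapp]
    congr 1
    funext t
    rw [smul_mul_assoc, mul_smul_comm, ← mul_assoc]
    congr 1
    change N.rotated (N.rotated T (0 - t)) β = _
    rw [rotated_rotated]
    congr 1
    ring
  refine ⟨G 0, ⟨?_, ?_⟩, ?_⟩
  · refine mem_alg_of_commute fun S hS v => ?_
    have h1 : ∀ u, G 0 u = ∫ t, φ.normed volume t • N.rotated T (0 - t) u := by
      intro u
      rw [hGapp, ContinuousLinearMap.integral_apply (hint 0)]
      rfl
    have hint1 := (hint 0).apply_continuousLinearMap v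
    have h2 := (S.restrictScalars ℝ).integral_comp_comm hint1
    rw [h1, h1]
    refine h2.symm.trans (integral_congr_ae (Filter.Eventually.of_forall fun t => ?_))
    change S (φ.normed volume t • N.rotated T (0 - t) v) =
      φ.normed volume t • N.rotated T (0 - t) (S v)
    rw [ContinuousLinearMap.map_smul_of_tower]
    by_cases ht : |t| < ε
    · rw [commutant_commute hS (hmem T hT _ (by rwa [zero_sub, abs_neg]))]
    · have : φ.normed volume t = 0 := by
        rw [← Function.notMem_support, φ.support_normed_eq]
        intro hb
        rw [Metric.mem_ball, dist_zero_right, Real.norm_eq_abs] at hb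
        exact ht (hb.trans_le (min_le_left _ _))
      rw [this, zero_smul, zero_smul]
  · rw [hrot]
    exact hφc.contDiff_convolution_left _ φ.contDiff_normed hc.locallyIntegrable
  · have h1 := φ.dist_normed_convolution_le (μ := volume) (x₀ := 0) (g := N.rotated T) (ε := η)
      hc.aestronglyMeasurable fun t ht => (hdist t ?_).le
    · rwa [rotated_zero] at h1
    · exact (Metric.mem_ball.mp ht).trans_le (min_le_right _ _)

/-- Smoothing takes two stages, each using up some room, hence `I₀` inside `I₁` inside `I`. Strong
averages of `T ∈ 𝒜(I₀)` lie in `𝒜(I₁)` and have norm-continuous orbits; convolution then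
approximates them in norm by elements of `𝒜^∞(I)`. The Reeh-Schlieder theorem is used for `I₀`. -/
theorem dense_smoothVacuumSpace (I : CircleInterval) :
    Dense (N.smoothVacuumSpace I : Set H) := by
  obtain ⟨I₁, hI₁⟩ := I.exists_closure_subset
  obtain ⟨I₀, hI₀⟩ := I₁.exists_closure_subset
  obtain ⟨ε, hε, hmem⟩ := exists_rotated_mem (N := N) hI₀
  have h1 : ∀ T ∈ N.alg I₁, Continuous (N.rotated T) →
      T N.Ω ∈ (N.smoothVacuumSpace I).topologicalClosure := by
    intro T hT hc
    refine Metric.mem_closure_iff.mpr fun η hη => ?_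
    obtain ⟨S, hS, hd⟩ := exists_smoothAlg_dist_le hI₁ hT hc (half_pos hη)
    refine ⟨S N.Ω, ⟨S, hS, rfl⟩, ?_⟩
    rw [dist_comm, dist_eq_norm, ← sub_apply]
    refine ((S - T).le_opNorm _).trans_lt ?_
    rw [N.vacuum_norm, mul_one, ← dist_eq_norm]
    linarith
  have h2 : N.localVacuumSpace I₀ ≤ (N.smoothVacuumSpace I).topologicalClosure := by
    rintro _ ⟨T, hT, rfl⟩
    -- The means `s⁻¹ ∫₀ˢ U(ρ_r) T U(ρ_r)* Ω dr` tend to `TΩ` as `s → 0`.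
    have hd := (hasDerivAt_rotationIntegral (N := N) T N.Ω).tendsto_slope_zero
    refine (N.smoothVacuumSpace I).isClosed_topologicalClosure.mem_of_tendsto hd ?_
    filter_upwards [nhdsWithin_le_nhds (Metric.ball_mem_nhds (0 : ℝ) hε)] with s hs
    rw [mem_ball_zero_iff, Real.norm_eq_abs] at hs
    have h3 : ∀ r : ℝ, |r| < ε → N.rotationIntegral T 0 r N.Ω ∈
        (N.smoothVacuumSpace I).topologicalClosure := by
      intro r hr
      refine h1 _ (rotationIntegral_mem fun t ht => hmem T hT t ?_)
        (continuous_rotated_rotationIntegral T 0 r)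
      have := Set.abs_sub_left_of_mem_uIcc ht
      simp only [sub_zero] at this
      exact this.trans_lt hr
    rw [zero_add]
    exact Submodule.smul_of_tower_mem _ _
      (Submodule.sub_mem _ (h3 s hs) (h3 0 (by rwa [abs_zero])))
  rw [Submodule.dense_iff_topologicalClosure_eq_top, eq_top_iff,
    ← Submodule.dense_iff_topologicalClosure_eq_top.mp (N.dense_localVacuumSpace I₀)]
  exact Submodule.topologicalClosure_minimal _ h2 (Submodule.isClosed_topologicalClosure _)

end MobiusCovariantNet

/-! ### The smooth local vectors form a core -/

theorem mainTheorem12 {H : Type*} [NormedAddCommGroup H] [InnerProductSpace ℂ H] [CompleteSpace H]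
    (N : MobiusCovariantNet H) (I : CircleInterval) (k : ℝ) (hk : 0 < k) :
    (N.L₀pow k).HasCore (N.smoothVacuumSpace I) := by
  obtain ⟨I₀, hI₀⟩ := I.exists_closure_subset
  obtain ⟨ε, hε, hmem⟩ := MobiusCovariantNet.exists_rotated_mem (N := N) hI₀
  refine N.positiveCircleGroup.hasCore_pow k ?_
    (MobiusCovariantNet.dense_smoothVacuumSpace (N := N) I₀) hε ?_
  · rintro _ ⟨T, hT, rfl⟩
    refine N.positiveCircleGroup.mem_domain_pow k ?_
    simp_rw [← N.rotated_apply_Ω]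
    -- Evaluation at the invariant vector `Ω` carries the smooth operator orbit to the orbit of
    -- `TΩ`.
    exact (ContinuousLinearMap.apply ℂ H N.Ω).restrictScalars ℝ |>.contDiff.comp hT.2
  · rintro _ ⟨T, hT, rfl⟩ t ht
    refine ⟨N.rotated T t, ⟨hmem T hT.1 t ht, ?_⟩, (N.rotated_apply_Ω T t).symm⟩
    have : N.rotated (N.rotated T t) = fun β => N.rotated T (t + β) :=
      funext fun β => N.rotated_rotated T t β
    rw [this]
    exact hT.2.comp (by fun_prop)
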